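/- **Setting.** A combinatorial problem $\mathfrak A$ is given by a set of instances; each instance $x$ has a finite ground set $\mathbb B$ of elements and a family $\mathcal F\subseteq 2^{\mathbb B}$ of feasible solutions. $\mathsf{Exact}$-$\mathfrak A$ asks, given an instance $x$, weights $w_b\in\mathbb N$ $(b\in\mathbb B)$ and $K\in\mathbb N$, for some $S\in\mathcal F$ with $\sum_{b\in S}w_b=K$, or the report that there is none; an algorithm for it is *pseudopolynomial* if its running time is bounded by a polynomial in the size of the input (numbers written in binary) and $K$. In the stochastic version one is given an instance $x$ and, for each $b\in\mathbb B$, an explicitly listed finite distribution, with nonnegative rational values and rational probabilities, of a random weight $X_b$; the $X_b$ are independent, and $X(S)=\sum_{b\in S}X_b$. Running times are those of a deterministic machine model that is polynomially equivalent to Turing machines. **Theorem.** Assume that $\mathsf{Exact}$-$\mathfrak A$ has a pseudopolynomial-time algorithm. 1. Let $\mu:\mathbb R\to\mathbb R$ be nonnegative and Lipschitz on $[0,\infty)$, with $\lim_{x\to\infty}\mu(x)=0$. Then for every $\epsilon>0$ there is an algorithm, running in time polynomial in the input size, that given an instance of $\mathfrak A$ with distributions of the weights finds a feasible $S$ with $$\mathbb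 E[\mu(X(S))]\ \ge\ \max_{S'\in\mathcal F}\mathbb E[\mu(X(S'))]-\epsilon ,$$ or reports that $\mathcal F=\emptyset$. 2. There is a relaxed additive PTAS for threshold probability maximization: an algorithm that takes a rational $\epsilon>0$ and an instance of $\mathfrak A$ with distributions of the weights, runs, for every fixed $\epsilon$, in time polynomial in the input size, and finds a feasible $S$ with $$\Pr[X(S)\le 1+\epsilon]\ \ge\ \max_{S'\in\mathcal F}\Pr[X(S')\le 1]-\epsilon ,$$ or reports that $\mathcal F=\emptyset$. -/

import Mathlib

open MeasureTheory Filter Topology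
open scoped NNReal ENNReal

namespace StochOpt

/-! ### The machine model

Programs are those of a pure Lisp-like `while` language on binary trees, the classical model whose
polynomial-time computable functions are the same as those of Turing machines: a tree is held by a
pointer to its root, and every elementary operation (allocating one node, following a pointer,
testing a pointer against `nil`, transfer of control) takes one unit of time. -/

/-- Binary trees, the data on which programs operate. -/
inductive Data : Type
  | nil : Data
  | cons : Data → Data → Data

namespace Data

/-- The size of a tree: its number of nodes, leaves included. -/
def size : Data → ℕ
  | nil => 1
  | cons a b => a.size + b.size + 1

/-- The left subtree (`nil` for a leaf). -/
def left : Data → Data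
  | nil => nil
  | cons a _ => a

/-- The right subtree (`nil` for a leaf). -/
def right : Data → Data
  | nil => nil
  | cons _ b => b

end Data

/-- Programs. A program acts on a single tree; see `Prog.Runs` for the meaning. -/
inductive Prog : Type
  | skip : Prog
  | leaf : Prog
  | left : Prog
  | right : Prog
  | pair : Prog → Prog → Prog
  | seq : Prog → Prog → Prog
  | ite : Prog → Prog → Prog → Prog
  | loop : Prog → Prog → Prog

/-- `p.Runs x y t`: on input `x`, the program `p` halts with output `y` after exactly `t` steps. -/
inductive Prog.Runs : Prog → Data → Data → ℕ → Prop
  | skip (x : Data) : Prog.Runs .skip x x 1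
  | leaf (x : Data) : Prog.Runs .leaf x .nil 1
  | left (x : Data) : Prog.Runs .left x x.left 1
  | right (x : Data) : Prog.Runs .right x x.right 1
  | pair {p q : Prog} {x y z : Data} {s t : ℕ} :
      Prog.Runs p x y s → Prog.Runs q x z t → Prog.Runs (.pair p q) x (.cons y z) (s + t + 1)
  | seq {p q : Prog} {x y z : Data} {s t : ℕ} :
      Prog.Runs p x y s → Prog.Runs q y z t → Prog.Runs (.seq p q) x z (s + t + 1)
  | ite_true {c p q : Prog} {x a b y : Data} {s t : ℕ} :
      Prog.Runs c x (.cons a b) s → Prog.Runs p x y t → Prog.Runs (.ite c p q) x y (s + t + 1)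
  | ite_false {c p q : Prog} {x y : Data} {s t : ℕ} :
      Prog.Runs c x .nil s → Prog.Runs q x y t → Prog.Runs (.ite c p q) x y (s + t + 1)
  | loop_stop {c p : Prog} {x : Data} {s : ℕ} :
      Prog.Runs c x .nil s → Prog.Runs (.loop c p) x x (s + 1)
  | loop_step {c p : Prog} {x a b y z : Data} {s t u : ℕ} :
      Prog.Runs c x (.cons a b) s → Prog.Runs p x y t → Prog.Runs (.loop c p) y z u →
      Prog.Runs (.loop c p) x z (s + t + u + 1)

/-- The machine model is deterministic. -/
theorem Prog.Runs.deterministic {p : Prog} {x y : Data} {t : ℕ} (h : p.Runs x y t) :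
    ∀ {y' : Data} {t' : ℕ}, p.Runs x y' t' → y = y' ∧ t = t' := by
  induction h with
  | skip x => intro _ _ h; cases h; exact ⟨rfl, rfl⟩
  | leaf x => intro _ _ h; cases h; exact ⟨rfl, rfl⟩
  | left x => intro _ _ h; cases h; exact ⟨rfl, rfl⟩
  | right x => intro _ _ h; cases h; exact ⟨rfl, rfl⟩
  | pair _ _ ih₁ ih₂ =>
    intro _ _ h
    cases h with
    | pair h₁ h₂ =>
      obtain ⟨rfl, rfl⟩ := ih₁ h₁
      obtain ⟨rfl, rfl⟩ := ih₂ h₂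
      exact ⟨rfl, rfl⟩
  | seq _ _ ih₁ ih₂ =>
    intro _ _ h
    cases h with
    | seq h₁ h₂ =>
      obtain ⟨rfl, rfl⟩ := ih₁ h₁
      obtain ⟨rfl, rfl⟩ := ih₂ h₂
      exact ⟨rfl, rfl⟩
  | ite_true _ _ ih₁ ih₂ =>
    intro _ _ h
    cases h with
    | ite_true h₁ h₂ =>
      obtain ⟨_, rfl⟩ := ih₁ h₁
      obtain ⟨rfl, rfl⟩ := ih₂ h₂
      exact ⟨rfl, rfl⟩
    | ite_false h₁ _ => exact absurd (ih₁ h₁).1 (by simp)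
  | ite_false _ _ ih₁ ih₂ =>
    intro _ _ h
    cases h with
    | ite_true h₁ _ => exact absurd (ih₁ h₁).1 (by simp)
    | ite_false h₁ h₂ =>
      obtain ⟨_, rfl⟩ := ih₁ h₁
      obtain ⟨rfl, rfl⟩ := ih₂ h₂
      exact ⟨rfl, rfl⟩
  | loop_stop _ ih₁ =>
    intro _ _ h
    cases h with
    | loop_stop h₁ =>
      obtain ⟨_, rfl⟩ := ih₁ h₁
      exact ⟨rfl, rfl⟩
    | loop_step h₁ _ _ => exact absurd (ih₁ h₁).1 (by simp)
  | loop_step _ _ _ ih₁ ih₂ ih₃ =>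
    intro _ _ h
    cases h with
    | loop_stop h₁ => exact absurd (ih₁ h₁).1 (by simp)
    | loop_step h₁ h₂ h₃ =>
      obtain ⟨_, rfl⟩ := ih₁ h₁
      obtain ⟨rfl, rfl⟩ := ih₂ h₂
      obtain ⟨rfl, rfl⟩ := ih₃ h₃
      exact ⟨rfl, rfl⟩

/-! ### Encodings -/

/-- Encoding of a truth value. -/
def encBool : Bool → Data
  | false => .nil
  | true => .cons .nil .nil

/-- Encoding of a list, given an encoding of its entries. -/
def encList {α : Type} (enc : α → Data) : List α → Data
  | [] => .nil
  | a :: l => .cons (enc a) (encList enc l)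

/-- Encoding of a natural number, in binary (least significant digit first). -/
def encNat (n : ℕ) : Data := encList encBool n.bits

/-- Encoding of a nonnegative rational number: numerator and denominator in binary. -/
def encRat (q : ℚ≥0) : Data := .cons (encNat q.num) (encNat q.den)

/-- Encoding of a subset of `{0, …, n - 1}`, by its characteristic vector. -/
def encSet {n : ℕ} (S : Finset (Fin n)) : Data :=
  encList encBool (List.ofFn fun i => decide (i ∈ S))

/-- Encoding of an answer: a set, or the report that there is none. -/
def encAnswer {n : ℕ} : Option (Finset (Fin n)) → Data
  | none => .nil
  | some S => .cons .nil (encSet S)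

/-! ### Combinatorial problems and their exact version -/

/-- A combinatorial optimization problem. Certain trees describe instances; an instance `x` has the
ground set `Fin (A.card x)` and a family of feasible subsets of it. -/
structure Problem : Type where
  /-- `IsInstance x`: the tree `x` describes an instance. -/
  IsInstance : Data → Prop
  /-- The number of elements of the ground set. -/
  card : Data → ℕ
  /-- The feasible solutions. -/
  Feasible : (x : Data) → Finset (Fin (card x)) → Prop

/-- The exact version of `A` (given an instance, natural weights of the elements and a target `K`,
find a feasible solution of weight exactly `K` or report that there is none) has an algorithm whose
running time is bounded by a polynomial in the input size and `K`. -/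
def Problem.ExactPseudoPoly (A : Problem) : Prop :=
  ∃ (P : Prog) (p : Polynomial ℕ),
    ∀ x : Data, A.IsInstance x → ∀ (w : Fin (A.card x) → ℕ) (K : ℕ),
      ∃ (out : Data) (t : ℕ),
        P.Runs (.cons x (.cons (encList encNat (List.ofFn w)) (encNat K))) out t ∧
        t ≤ p.eval
          ((Data.cons x (.cons (encList encNat (List.ofFn w)) (encNat K))).size + K) ∧
        ((∃ S, A.Feasible x S ∧ ∑ b ∈ S, w b = K ∧ out = encAnswer (some S)) ∨
          ((¬ ∃ S, A.Feasible x S ∧ ∑ b ∈ S, w b = K) ∧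
            out = encAnswer (n := A.card x) none))

/-! ### Random weights -/

/-- A discrete distribution on the nonnegative reals, given explicitly by a finite list of pairs
(value, probability) of rational numbers. -/
structure Dist : Type where
  /-- The pairs (value, probability). -/
  atoms : List (ℚ≥0 × ℚ≥0)
  /-- The probabilities add up to one. -/
  sum_prob : (atoms.map Prod.snd).sum = 1

/-- Encoding of a distribution: the list of its pairs (value, probability). -/
def encDist (d : Dist) : Data :=
  encList (fun a : ℚ≥0 × ℚ≥0 => .cons (encRat a.1) (encRat a.2)) d.atoms

/-- The distribution as a measure on `ℝ`. -/
noncomputable def Dist.law (d : Dist) : Measure ℝ :=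
  (d.atoms.map fun a => ENNReal.ofReal (a.2 : ℝ) • Measure.dirac (a.1 : ℝ)).sum

/-- The joint law of independent weights `X_b` with the given distributions. -/
noncomputable def jointLaw {n : ℕ} (π : Fin n → Dist) : Measure (Fin n → ℝ) :=
  Measure.pi fun b => (π b).law

/-- The expected utility `E[μ(X(S))]`, where `X(S) = ∑ b ∈ S, X_b`. -/
noncomputable def expUtility {n : ℕ} (μ : ℝ → ℝ) (π : Fin n → Dist) (S : Finset (Fin n)) : ℝ :=
  ∫ X, μ (∑ b ∈ S, X b) ∂(jointLaw π)

/-- The probability `Pr[X(S) ≤ c]`. -/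
noncomputable def probLE {n : ℕ} (π : Fin n → Dist) (S : Finset (Fin n)) (c : ℝ) : ℝ :=
  (jointLaw π).real {X | ∑ b ∈ S, X b ≤ c}

/-- The optimal value of an objective over the feasible solutions (a maximum over a finite
family; meant when the family is not empty). -/
noncomputable def Problem.opt (A : Problem) (x : Data)
    (f : Finset (Fin (A.card x)) → ℝ) : ℝ :=
  ⨆ S : {S : Finset (Fin (A.card x)) // A.Feasible x S}, f S

/-- The input of a stochastic problem: an instance together with the distributions of the weights
of the elements of its ground set. -/
def encStoch {n : ℕ} (x : Data) (π : Fin n → Dist) : Data :=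
  .cons x (encList encDist (List.ofFn π))

/-- There is a polynomial-time algorithm that, given an instance of `A` with distributions of the
weights, finds a feasible `S` with `E[μ(X(S))] ≥ OPT - ε`, where `OPT` is the largest expected
utility of a feasible solution (or reports that no feasible solution exists). -/
def Problem.EUMPolyTime (A : Problem) (μ : ℝ → ℝ) (ε : ℝ) : Prop :=
  ∃ (P : Prog) (p : Polynomial ℕ),
    ∀ x : Data, A.IsInstance x → ∀ π : Fin (A.card x) → Dist,
      ∃ (out : Data) (t : ℕ),
        P.Runs (encStoch x π) out t ∧ t ≤ p.eval (encStoch x π).size ∧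
        ((∃ S, A.Feasible x S ∧ A.opt x (expUtility μ π) - ε ≤ expUtility μ π S ∧
            out = encAnswer (some S)) ∨
          ((¬ ∃ S, A.Feasible x S) ∧ out = encAnswer (n := A.card x) none))

/-- A relaxed additive polynomial-time approximation scheme for threshold probability
maximization: one algorithm, which takes `ε > 0` as a part of the input, whose running time for
every fixed `ε` is polynomial in the size of the rest of the input, and which finds a feasible `S`
with `Pr[X(S) ≤ 1 + ε] ≥ OPT - ε`, where `OPT` is the largest value of `Pr[X(S') ≤ 1]` over the
feasible `S'` (or reports that no feasible solution exists). -/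
def Problem.TPMRelaxedAdditivePTAS (A : Problem) : Prop :=
  ∃ P : Prog, ∀ ε : ℚ≥0, 0 < ε → ∃ p : Polynomial ℕ,
    ∀ x : Data, A.IsInstance x → ∀ π : Fin (A.card x) → Dist,
      ∃ (out : Data) (t : ℕ),
        P.Runs (.cons (encRat ε) (encStoch x π)) out t ∧ t ≤ p.eval (encStoch x π).size ∧
        ((∃ S, A.Feasible x S ∧
            A.opt x (fun S' => probLE π S' 1) - (ε : ℝ) ≤ probLE π S (1 + (ε : ℝ)) ∧
            out = encAnswer (some S)) ∨
          ((¬ ∃ S, A.Feasible x S) ∧ out = encAnswer (n := A.card x) none))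

end StochOpt

/-! Both objectives are expectations of functions of the random sum `X(S)`, and the proof replaces
such a function by a combination of exponentials `exp (-κ y)` with boundedly many terms. The
substitution `t = exp (-y)` turns a continuous function on `[0, ∞)` that tends to zero at infinity
into a continuous function on `[0, 1]`. Weierstrass then gives a polynomial in `exp (-y)` with
rational coefficients (`exists_expSum_near`). For the threshold the explicit step `1 - (1 - exp (-j²
y)) ^ b` with `b` about `2 ^ j * exp (j²)` is used, because `ε` is then part of the input and the
terms must be computed from it (`step_of_le_one`, `step_of_ge`).

By independence `E[exp (-κ X(S))]` is the product over `b ∈ S` of the Laplace transforms of the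
`X_b` (`integral_exp_sum`). Rounding `-N log` of each factor to a capped natural number makes every
product a function of an additive weight of `S`. Only additive accuracy matters, so tiny or
vanishing factors do no harm, and an `N` polynomial in the input suffices (`abs_exactObj_sub_le`).

The weights belonging to the different terms are packed as digits, to a base `B` too large for
carries, into one natural weight per element. There are then polynomially many targets `K`. The
exact algorithm is run for each of them, the approximate objective is read off from the digits of
`K` alone, and the best realizable `K` wins (`exists_algorithm`).

Running times are handled by the predicate `PT`, which is closed under composition, pairing,
branching and folds whose states stay polynomially bounded. Exponents may depend on the parameter,
which expresses polynomial time for fixed `ε`. -/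

namespace StochOpt

/-! ### Polynomial-time functions between encoded types -/

/-- A type whose elements are encoded by trees. -/
class Coded (α : Type) where
  /-- The encoding. -/
  enc : α → Data

/-- A type of inputs that carry a parameter; running times are polynomial for a fixed parameter. -/
class Env (Γ : Type) where
  /-- The parameter of an input. -/
  par : Γ → ℚ≥0

open Coded Env

/-- The unary encoding of a natural number. -/
def encUnary : ℕ → Data
  | 0 => .nil
  | n + 1 => .cons .nil (encUnary n)

instance : Coded Data := ⟨id⟩
instance : Coded Bool := ⟨encBool⟩
instance : Coded Unit := ⟨fun _ => .nil⟩
-- Internal numbers are unary: their values are kept polynomially bounded, so arithmetic can be done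
-- by iteration. Binary numbers appear as `List Bool`.
instance : Coded ℕ := ⟨encUnary⟩
instance : Coded ℚ≥0 := ⟨encRat⟩
instance : Coded Dist := ⟨encDist⟩
instance {α : Type} [Coded α] : Coded (List α) := ⟨encList enc⟩
instance {α β : Type} [Coded α] [Coded β] : Coded (α × β) := ⟨fun a => .cons (enc a.1) (enc a.2)⟩
-- A pair is a context extended by a local variable; the parameter remains that of the original
-- input.
instance {Γ α : Type} [Env Γ] : Env (Γ × α) := ⟨fun c => par c.1⟩

/-- The size of the encoding. -/
def sz {α : Type} [Coded α] (a : α) : ℕ := (enc a).size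

theorem Data.size_pos (d : Data) : 1 ≤ d.size := by
  cases d <;> simp [Data.size]

/-! ### Sizes of encoded data -/

section Size

variable {α β : Type} [Coded α] [Coded β]

theorem one_le_sz (a : α) : 1 ≤ sz a := Data.size_pos _

@[simp] theorem sz_nat (n : ℕ) : sz n = 2 * n + 1 := by
  induction n with
  | zero => rfl
  | succ n ih =>
    have : sz (n + 1) = 1 + sz n + 1 := rfl
    omega

@[simp] theorem sz_pair (a : α) (b : β) : sz (a, b) = sz a + sz b + 1 := rfl

theorem sz_prod (a : α × β) : sz a = sz a.1 + sz a.2 + 1 := rfl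

@[simp] theorem sz_nil : sz ([] : List α) = 1 := rfl

@[simp] theorem sz_cons (a : α) (l : List α) : sz (a :: l) = sz a + sz l + 1 := rfl

theorem sz_bool_le (b : Bool) : sz b ≤ 3 := by
  cases b <;> simp [sz, enc, encBool, Data.size]

theorem sz_le_of_mem {a : α} {l : List α} (h : a ∈ l) : sz a ≤ sz l := by
  induction l with
  | nil => simp at h
  | cons b l ih =>
    rcases List.mem_cons.1 h with rfl | h
    · simp only [sz_cons]; omega
    · have := ih h
      simp only [sz_cons]; omega

theorem length_le_sz (l : List α) : l.length ≤ sz l := by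
  induction l with
  | nil => simp
  | cons b l ih => simp only [sz_cons, List.length_cons]; omega

theorem sz_append (l₁ l₂ : List α) : sz (l₁ ++ l₂) + 1 = sz l₁ + sz l₂ := by
  induction l₁ with
  | nil => simp; omega
  | cons b l ih => simp only [sz_cons, List.cons_append]; omega

theorem sz_reverse (l : List α) : sz l.reverse = sz l := by
  induction l with
  | nil => rfl
  | cons b l ih =>
    have := sz_append l.reverse [b]
    simp only [List.reverse_cons, sz_cons, sz_nil] at *
    omega

end Size

/-- `f` is bounded by a polynomial in the size of the input, for every fixed parameter. -/
def PolyBdd {Γ : Type} [Coded Γ] [Env Γ] (f : Γ → ℕ) : Prop :=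
  ∃ k : ℚ≥0 → ℕ, ∀ c, f c ≤ (sz c + 1) ^ k (par c)

namespace PolyBdd

variable {Γ Δ : Type} [Coded Γ] [Env Γ] [Coded Δ] [Env Δ] {f g : Γ → ℕ}

theorem mono (hg : PolyBdd g) (h : ∀ c, f c ≤ g c) : PolyBdd f := by
  obtain ⟨k, hk⟩ := hg
  exact ⟨k, fun c => (h c).trans (hk c)⟩

/-- The base `sz c + 1` is at least `2`, and `n < 2 ^ n`, so the bound itself can serve as the
exponent. -/
theorem of_par (h : ℚ≥0 → ℕ) (hf : ∀ c, f c ≤ h (par c)) : PolyBdd f := by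
  refine ⟨h, fun c => (hf c).trans ?_⟩
  have := one_le_sz c
  exact Nat.lt_two_pow_self.le.trans (Nat.pow_le_pow_left (by omega) _)

theorem const (n : ℕ) : PolyBdd (fun _ : Γ => n) := of_par (fun _ => n) fun _ => le_rfl

theorem size : PolyBdd (fun c : Γ => sz c) := ⟨fun _ => 1, fun c => by simp⟩

theorem add (hf : PolyBdd f) (hg : PolyBdd g) : PolyBdd (fun c => f c + g c) := by
  obtain ⟨k, hk⟩ := hf
  obtain ⟨l, hl⟩ := hg
  refine ⟨fun e => k e + l e + 1, fun c => ?_⟩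
  have h1 := one_le_sz c
  have e1 : (sz c + 1) ^ k (par c) ≤ (sz c + 1) ^ (k (par c) + l (par c)) :=
    Nat.pow_le_pow_right (by omega) (by omega)
  have e2 : (sz c + 1) ^ l (par c) ≤ (sz c + 1) ^ (k (par c) + l (par c)) :=
    Nat.pow_le_pow_right (by omega) (by omega)
  have e3 := hk c
  have e4 := hl c
  rw [pow_succ]
  have e5 : (sz c + 1) ^ (k (par c) + l (par c)) * 2 ≤
    (sz c + 1) ^ (k (par c) + l (par c)) * (sz c + 1) := Nat.mul_le_mul_left _ (by omega)
  beta_reduce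
  omega

theorem mul (hf : PolyBdd f) (hg : PolyBdd g) : PolyBdd (fun c => f c * g c) := by
  obtain ⟨k, hk⟩ := hf
  obtain ⟨l, hl⟩ := hg
  exact ⟨fun e => k e + l e, fun c => by
    rw [pow_add]; exact Nat.mul_le_mul (hk c) (hl c)⟩

theorem add_const (hf : PolyBdd f) (n : ℕ) : PolyBdd (fun c => f c + n) := hf.add (const n)

theorem pow_par (hf : PolyBdd f) (h : ℚ≥0 → ℕ) (hg : ∀ c, g c ≤ h (par c)) :
    PolyBdd (fun c => f c ^ g c) := by
  obtain ⟨k, hk⟩ := hf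
  refine ⟨fun e => k e * h e, fun c => ?_⟩
  rw [pow_mul]
  exact (Nat.pow_le_pow_left (hk c) _).trans (Nat.pow_le_pow_right (by positivity) (hg c))

theorem comp {F : Δ → ℕ} (hF : PolyBdd F) {u : Γ → Δ} (hu : PolyBdd fun c => sz (u c))
    (hp : ∀ c, par (u c) = par c) : PolyBdd (fun c => F (u c)) := by
  obtain ⟨k, hk⟩ := hF
  have := (hu.add_const 1).pow_par (g := fun c => k (par c)) k (fun _ => le_rfl)
  exact this.mono fun c => by have := hk (u c); rwa [hp] at this

/-- A polynomially bounded function of the input and an element of polynomially bounded size is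
bounded by a polynomially bounded function of the input alone. -/
theorem exists_bound {α : Type} [Coded α] {F : Γ × α → ℕ} (hF : PolyBdd F) {D : Γ → ℕ}
    (hD : PolyBdd D) : ∃ E : Γ → ℕ, PolyBdd E ∧ ∀ c a, sz a ≤ D c → F (c, a) ≤ E c := by
  obtain ⟨k, hk⟩ := hF
  refine ⟨fun c => (sz c + D c + 1 + 1) ^ k (par c),
    ((((size.add hD).add_const 1).add_const 1)).pow_par k (fun _ => le_rfl), fun c a ha => ?_⟩
  exact (hk (c, a)).trans (Nat.pow_le_pow_left (by simp only [sz_pair]; omega) _)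

end PolyBdd

/-! ### Closure properties of polynomial-time functions -/

/-- `f` is computable in time polynomial in the size of the input, for every fixed parameter, and
the size of its values is bounded in the same way. -/
def PT {Γ β : Type} [Coded Γ] [Env Γ] [Coded β] (f : Γ → β) : Prop :=
  ∃ (P : Prog) (T : Γ → ℕ), PolyBdd T ∧ PolyBdd (fun c => sz (f c)) ∧
    ∀ c, ∃ t ≤ T c, P.Runs (enc c) (enc (f c)) t

/-- The body of a fold: the state of the loop is `(c, (s, l))`. -/
def foldBody (P : Prog) : Prog :=
  .pair .left (.pair (.seq (.pair (.pair .left (.seq .right .left))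
    (.seq .right (.seq .right .left))) P) (.seq .right (.seq .right .right)))

/-- The hypothesis concerns only states reached along prefixes of the list, since only there is the
size of the state, and hence the time of a step, under control. The `30` is slack for the
projections and pairings of one round; the final test costs `4`. -/
theorem foldBody_loop_runs {α σ : Type} [Coded α] [Coded σ] (P : Prog) (c : Data)
    (st : σ → α → σ) (T : ℕ) : ∀ (l : List α) (s : σ),
    (∀ l₁ a l₂, l = l₁ ++ a :: l₂ → ∃ t ≤ T, P.Runs
      (.cons (.cons c (enc (l₁.foldl st s))) (enc a)) (enc (st (l₁.foldl st s) a)) t) →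
    ∃ t ≤ l.length * (T + 30) + 4,
      (Prog.loop (.seq .right .right) (foldBody P)).Runs (.cons c (.cons (enc s) (enc l)))
        (.cons c (.cons (enc (l.foldl st s)) .nil)) t := by
  intro l
  induction l with
  | nil =>
    intro s _
    exact ⟨4, by simp, Prog.Runs.loop_stop (.seq (.right _) (.right _))⟩
  | cons a l ih =>
    intro s h
    obtain ⟨t₁, ht₁, h₁⟩ := h [] a l rfl
    obtain ⟨t₂, ht₂, h₂⟩ := ih (st s a) (fun l₁ b l₂ e => by
      have := h (a :: l₁) b l₂ (by simp [e])
      simpa using this)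
    refine ⟨_, ?_, .loop_step (a := enc a) (b := enc l) (.seq (.right _) (.right _))
      (.pair (.left _) (.pair (.seq (.pair (.pair (.left _) (.seq (.right _) (.left _)))
        (.seq (.right _) (.seq (.right _) (.left _)))) h₁)
        (.seq (.right _) (.seq (.right _) (.right _))))) h₂⟩
    simp only [List.length_cons, Nat.add_mul, Nat.one_mul]
    omega

namespace PT

variable {Γ Δ α β γ σ : Type} [Coded Γ] [Env Γ] [Coded Δ] [Env Δ] [Coded α] [Coded β] [Coded γ]
  [Coded σ]

theorem polyBdd {f : Γ → β} (hf : PT f) : PolyBdd (fun c => sz (f c)) :=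
  hf.choose_spec.choose_spec.2.1

theorem polyBdd_nat {f : Γ → ℕ} (hf : PT f) : PolyBdd f :=
  hf.polyBdd.mono fun c => by rw [sz_nat]; omega

/-- Only the encoding of the result matters. -/
theorem recode {f : Γ → β} (hf : PT f) {g : Γ → γ} (h : ∀ c, enc (g c) = enc (f c)) : PT g := by
  obtain ⟨P, T, hT, hs, hr⟩ := hf
  exact ⟨P, T, hT, hs.mono fun _ => by simp only [sz, h]; exact le_rfl,
    fun c => by simpa only [h] using hr c⟩

theorem congr {f g : Γ → β} (hf : PT f) (h : ∀ c, g c = f c) : PT g :=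
  hf.recode fun c => by rw [h]

theorem id : PT (fun c : Γ => c) :=
  ⟨.skip, fun _ => 1, .const 1, .size, fun _ => ⟨1, le_rfl, .skip _⟩⟩

theorem comp {g : Δ → β} (hg : PT g) {f : Γ → Δ} (hf : PT f) (hp : ∀ c, par (f c) = par c) :
    PT (fun c => g (f c)) := by
  have hs := hf.polyBdd
  obtain ⟨P, T, hT, _, hr⟩ := hf
  obtain ⟨P', T', hT', hs', hr'⟩ := hg
  refine ⟨.seq P P', fun c => T c + T' (f c) + 1, (hT.add (hT'.comp hs hp)).add_const 1,
    hs'.comp hs hp, fun c => ?_⟩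
  obtain ⟨t, ht, h⟩ := hr c
  obtain ⟨t', ht', h'⟩ := hr' (f c)
  exact ⟨_, by beta_reduce; omega, .seq h h'⟩

theorem pair {f : Γ → α} {g : Γ → β} (hf : PT f) (hg : PT g) : PT (fun c => (f c, g c)) := by
  obtain ⟨P, T, hT, hs, hr⟩ := hf
  obtain ⟨P', T', hT', hs', hr'⟩ := hg
  refine ⟨.pair P P', fun c => T c + T' c + 1, (hT.add hT').add_const 1,
    (hs.add hs').add_const 1, fun c => ?_⟩
  obtain ⟨t, ht, h⟩ := hr c
  obtain ⟨t', ht', h'⟩ := hr' c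
  exact ⟨_, by beta_reduce; omega, .pair h h'⟩

/-- Appending an instruction that takes one step and does not increase the size. -/
theorem andThen {f : Γ → α} (hf : PT f) {g : Γ → β} (P : Prog)
    (hP : ∀ c, P.Runs (enc (f c)) (enc (g c)) 1) (hs : ∀ c, sz (g c) ≤ sz (f c)) : PT g := by
  have hb := hf.polyBdd
  obtain ⟨Q, T, hT, _, hr⟩ := hf
  refine ⟨.seq Q P, fun c => T c + 2, hT.add_const 2, hb.mono hs, fun c => ?_⟩
  obtain ⟨t, ht, h⟩ := hr c
  exact ⟨_, by beta_reduce; omega, .seq h (hP c)⟩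

theorem fst {f : Γ → α × β} (hf : PT f) : PT (fun c => (f c).1) :=
  hf.andThen .left (fun _ => .left _) fun c => by rw [sz_prod (f c)]; omega

theorem snd {f : Γ → α × β} (hf : PT f) : PT (fun c => (f c).2) :=
  hf.andThen .right (fun _ => .right _) fun c => by rw [sz_prod (f c)]; omega

theorem arg : PT (fun d : Γ × α => d.2) := id.snd

theorem env : PT (fun d : Γ × α => d.1) := id.fst

/-- Weakening of the context. -/
theorem wk {f : Γ → β} (hf : PT f) : PT (fun d : Γ × α => f d.1) := hf.comp env fun _ => rfl

theorem exists_prog_const (d : Data) : ∃ (P : Prog) (t : ℕ), ∀ x, P.Runs x d t := by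
  induction d with
  | nil => exact ⟨.leaf, 1, fun x => .leaf x⟩
  | cons a b iha ihb =>
    obtain ⟨P, s, hP⟩ := iha
    obtain ⟨Q, t, hQ⟩ := ihb
    exact ⟨.pair P Q, s + t + 1, fun x => .pair (hP x) (hQ x)⟩

theorem const (b : β) : PT (fun _ : Γ => b) := by
  obtain ⟨P, t, h⟩ := exists_prog_const (enc b)
  exact ⟨P, fun _ => t, .const t, .const _, fun c => ⟨t, le_rfl, h _⟩⟩

theorem ite {b : Γ → Bool} {f g : Γ → β} (hb : PT b) (hf : PT f) (hg : PT g) :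
    PT (fun c => if b c = true then f c else g c) := by
  obtain ⟨P₀, T₀, hT₀, -, hr₀⟩ := hb
  obtain ⟨P, T, hT, hs, hr⟩ := hf
  obtain ⟨P', T', hT', hs', hr'⟩ := hg
  refine ⟨.ite P₀ P P', fun c => T₀ c + (T c + T' c) + 1, (hT₀.add (hT.add hT')).add_const 1,
    (hs.add hs').mono fun c => by beta_reduce; split <;> omega, fun c => ?_⟩
  obtain ⟨t₀, ht₀, h₀⟩ := hr₀ c
  obtain ⟨t, ht, h⟩ := hr c
  obtain ⟨t', ht', h'⟩ := hr' c
  cases hbc : b c with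
  | true =>
    rw [hbc] at h₀
    simp only [hbc, if_true]
    exact ⟨_, by omega, .ite_true h₀ h⟩
  | false =>
    rw [hbc] at h₀
    simp only [hbc, Bool.false_eq_true, if_false]
    exact ⟨_, by omega, .ite_false h₀ h'⟩

/-- Folds over lists, provided that the intermediate states are polynomially bounded. -/
theorem foldl {l : Γ → List α} {i : Γ → σ} {st : Γ → σ → α → σ} (hl : PT l) (hi : PT i)
    (hst : PT fun d : (Γ × σ) × α => st d.1.1 d.1.2 d.2) {B : Γ → ℕ} (hB : PolyBdd B)
    (hb : ∀ c l₁, l₁ <+: l c → sz (l₁.foldl (st c) (i c)) ≤ B c) :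
    PT (fun c => (l c).foldl (st c) (i c)) := by
  have hsl := hl.polyBdd
  obtain ⟨Pl, Tl, hTl, -, hrl⟩ := hl
  obtain ⟨Pi, Ti, hTi, -, hri⟩ := hi
  obtain ⟨P, T, hT, -, hr⟩ := hst
  -- The time of a step depends on context, state and list entry. The entry is eliminated by the
  -- size of the list, then the state by `B`.
  obtain ⟨E₁, hE₁, hE₁'⟩ := hT.exists_bound (D := fun d => sz (l d.1))
    (hsl.comp PT.env.polyBdd fun _ => rfl)
  obtain ⟨E, hE, hE'⟩ := hE₁.exists_bound hB
  refine ⟨.seq (.pair .skip (.pair Pi Pl)) (.seq (.loop (.seq .right .right) (foldBody P))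
    (.seq .right .left)), fun c => Ti c + Tl c + sz (l c) * (E c + 30) + 20,
    ((hTi.add hTl).add (hsl.mul (hE.add_const 30))).add_const 20,
    hB.mono fun c => hb c _ (List.prefix_refl _), fun c => ?_⟩
  obtain ⟨tl, htl, hl⟩ := hrl c
  obtain ⟨ti, hti, hi⟩ := hri c
  obtain ⟨t, ht, h⟩ := foldBody_loop_runs P (enc c) (st c) (E c) (l c) (i c) (by
    intro l₁ a l₂ e
    obtain ⟨t, ht, h⟩ := hr ((c, l₁.foldl (st c) (i c)), a)
    refine ⟨t, ht.trans ((hE₁' _ _ ?_).trans (hE' _ _ ?_)), h⟩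
    · exact sz_le_of_mem (by simp [e])
    · exact hb c l₁ ⟨_, e.symm⟩)
  refine ⟨_, ?_, .seq (.pair (.skip _) (.pair hi hl)) (.seq h (.seq (.right _) (.left _)))⟩
  have := Nat.mul_le_mul_right (E c + 30) (length_le_sz (l c))
  beta_reduce
  omega

/-- Folds over lists in which every step adds a bounded amount to the size of the state. -/
theorem foldl_add {l : Γ → List α} {i : Γ → σ} {st : Γ → σ → α → σ} (hl : PT l) (hi : PT i)
    (hst : PT fun d : (Γ × σ) × α => st d.1.1 d.1.2 d.2) {D : Γ → ℕ} (hD : PolyBdd D)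
    (hd : ∀ c s a, a ∈ l c → sz (st c s a) ≤ sz s + D c) :
    PT (fun c => (l c).foldl (st c) (i c)) := by
  refine foldl hl hi hst (hi.polyBdd.add (hl.polyBdd.mul hD)) fun c l₁ h => ?_
  have key : ∀ l₁ : List α, (∀ a ∈ l₁, a ∈ l c) → ∀ s,
      sz (l₁.foldl (st c) s) ≤ sz s + l₁.length * D c := by
    intro l₁
    induction l₁ with
    | nil => intro _ s; simp
    | cons a l₁ ih =>
      intro h s
      have h₁ := ih (fun a ha => h a (by simp [ha])) (st c s a)
      have h₂ := hd c s a (h a (by simp))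
      simp only [List.foldl_cons, List.length_cons, Nat.add_mul, Nat.one_mul]
      omega
  have h₁ := key l₁ (fun a ha => h.subset ha) (i c)
  have h₂ := Nat.mul_le_mul_right (D c) (h.length_le.trans (length_le_sz (l c)))
  omega

end PT

/-- The test for the empty tree. -/
def Data.isNil : Data → Bool
  | .nil => true
  | .cons _ _ => false

/-! ### Lists and unary arithmetic in polynomial time -/

theorem enc_replicate_unit (n : ℕ) : enc (List.replicate n ()) = enc n := by
  induction n with
  | zero => rfl
  | succ n ih => exact congrArg (Data.cons .nil) ih

theorem foldl_replicate_unit {σ : Type} (f : σ → σ) (n : ℕ) (s : σ) :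
    (List.replicate n ()).foldl (fun s _ => f s) s = f^[n] s := by
  induction n generalizing s with
  | zero => rfl
  | succ n ih => simp [List.replicate_succ, ih]

theorem countP_eq_foldl {α : Type} (p : α → Bool) (l : List α) (n : ℕ) :
    l.foldl (fun s a => if p a = true then s + 1 else s) n = n + l.countP p := by
  induction l generalizing n with
  | nil => rfl
  | cons a l ih =>
    simp only [List.foldl_cons, List.countP_cons, ih]
    split <;> omega

theorem foldl_add_map {α : Type} (f : α → ℕ) (l : List α) (n : ℕ) :
    l.foldl (fun s a => s + f a) n = n + (l.map f).sum := by
  induction l generalizing n with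
  | nil => rfl
  | cons a l ih => simp [ih, Nat.add_assoc]

/-- Division becomes a count of the positive multiples of `b` up to `a`, which a fold can perform.
-/
theorem countP_range_mul_le (a b : ℕ) (hb : 0 < b) :
    (List.range a).countP (fun i => decide ((i + 1) * b ≤ a)) = a / b := by
  have key : ∀ n, (List.range n).countP (fun i => decide ((i + 1) * b ≤ a)) = min n (a / b) := by
    intro n
    induction n with
    | zero => simp
    | succ n ih =>
      rw [List.range_succ, List.countP_append, ih, List.countP_singleton]
      have : (n + 1) * b ≤ a ↔ n + 1 ≤ a / b := (Nat.le_div_iff_mul_le hb).symm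
      by_cases h : (n + 1) * b ≤ a
      · have := this.1 h
        simp only [h, decide_true, if_true]
        omega
      · have := mt this.2 h
        simp only [h, decide_false, Bool.false_eq_true, if_false]
        omega
  rw [key]
  exact min_eq_right (Nat.div_le_self a b)

namespace PT

variable {Γ α β σ : Type} [Coded Γ] [Env Γ] [Coded α] [Coded β] [Coded σ]

theorem cons {f : Γ → α} {l : Γ → List α} (hf : PT f) (hl : PT l) : PT (fun c => f c :: l c) :=
  (hf.pair hl).recode fun _ => rfl

theorem tail {l : Γ → List α} (hl : PT l) : PT (fun c => (l c).tail) := by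
  refine hl.andThen .right (fun c => ?_) fun c => ?_
  · cases l c with
    | nil => exact .right _
    | cons a l => exact .right _
  · cases l c with
    | nil => simp
    | cons a l => simp only [List.tail_cons, sz_cons]; omega

theorem headI {l : Γ → List Bool} (hl : PT l) : PT (fun c => (l c).headI) := by
  refine hl.andThen .left (fun c => ?_) fun c => ?_
  · cases l c with
    | nil => exact .left _
    | cons a l => exact .left _
  · cases l c with
    | nil => exact le_rfl
    | cons a l => simp only [List.headI, sz_cons]; omega

theorem reverse {l : Γ → List α} (hl : PT l) : PT (fun c => (l c).reverse) := by
  refine (foldl_add (st := fun _ s a => a :: s) hl (const []) (arg.cons env.snd)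
    (hl.polyBdd.add_const 1) fun c s a ha => ?_).congr fun c => ?_
  · have := sz_le_of_mem ha
    simp only [sz_cons]; omega
  · simp

theorem map {l : Γ → List α} {f : Γ → α → β} (hl : PT l) (hf : PT fun d : Γ × α => f d.1 d.2) :
    PT (fun c => (l c).map (f c)) := by
  obtain ⟨E, hE, hE'⟩ := hf.polyBdd.exists_bound hl.polyBdd
  refine (foldl_add (st := fun c s a => f c a :: s) hl (const [])
    ((hf.comp (env.fst.pair arg) fun _ => rfl).cons env.snd)
    (hE.add_const 1) fun c s a ha => ?_).reverse.congr fun c => ?_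
  · have := hE' c a (sz_le_of_mem ha)
    simp only [sz_cons] at this ⊢; omega
  · simp

theorem replicate_unit {n : Γ → ℕ} (hn : PT n) : PT (fun c => List.replicate (n c) ()) :=
  hn.recode fun _ => enc_replicate_unit _

/-- Iteration of a step that adds a bounded amount to the size of the state. -/
theorem iterate {n : Γ → ℕ} {i : Γ → σ} {st : Γ → σ → σ} (hn : PT n) (hi : PT i)
    (hst : PT fun d : Γ × σ => st d.1 d.2) {D : Γ → ℕ} (hD : PolyBdd D)
    (hd : ∀ c s, sz (st c s) ≤ sz s + D c) : PT (fun c => (st c)^[n c] (i c)) :=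
  (foldl_add (st := fun c s _ => st c s) hn.replicate_unit hi hst.wk hD
    fun c s _ _ => hd c s).congr fun _ => (foldl_replicate_unit _ _ _).symm

/-- Iteration with polynomially bounded intermediate states. -/
theorem iterate_of_bdd {n : Γ → ℕ} {i : Γ → σ} {st : Γ → σ → σ} (hn : PT n) (hi : PT i)
    (hst : PT fun d : Γ × σ => st d.1 d.2) {B : Γ → ℕ} (hB : PolyBdd B)
    (hb : ∀ c k, k ≤ n c → sz ((st c)^[k] (i c)) ≤ B c) : PT (fun c => (st c)^[n c] (i c)) := by
  refine (foldl (st := fun c s _ => st c s) hn.replicate_unit hi hst.wk hB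
    fun c l₁ h => ?_).congr fun c => (foldl_replicate_unit _ _ _).symm
  have hl := h.length_le
  rw [List.length_replicate] at hl
  have : l₁ = List.replicate l₁.length () := List.eq_replicate_iff.2 ⟨rfl, fun _ _ => rfl⟩
  rw [this, foldl_replicate_unit]
  exact hb c _ hl

theorem succ {f : Γ → ℕ} (hf : PT f) : PT (fun c => f c + 1) :=
  ((const ()).pair hf).recode fun _ => rfl

theorem pred {f : Γ → ℕ} (hf : PT f) : PT (fun c => f c - 1) := by
  refine hf.andThen .right (fun c => ?_) fun c => by simp only [sz_nat]; omega
  cases f c with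
  | zero => exact .right _
  | succ n => exact .right _

theorem add {f g : Γ → ℕ} (hf : PT f) (hg : PT g) : PT (fun c => f c + g c) :=
  (iterate (st := fun _ s => s + 1) hg hf arg.succ (.const 2)
    fun c s => by simp only [sz_nat]; omega).congr fun c => by simp

theorem sub {f g : Γ → ℕ} (hf : PT f) (hg : PT g) : PT (fun c => f c - g c) :=
  (iterate (st := fun _ s => s - 1) hg hf arg.pred (.const 0)
    fun c s => by simp only [sz_nat]; omega).congr fun _ => (Nat.pred_iterate _ _).symm

theorem mul {f g : Γ → ℕ} (hf : PT f) (hg : PT g) : PT (fun c => f c * g c) :=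
  (iterate (st := fun c s => s + f c) hg (const 0) (arg.add hf.wk) hf.polyBdd
    fun c s => by simp only [sz_nat]; omega).congr fun c => by simp [mul_comm]

theorem pow_par {f g : Γ → ℕ} (hf : PT f) (hg : PT g) (h : ℚ≥0 → ℕ)
    (hgh : ∀ c, g c ≤ h (par c)) : PT (fun c => f c ^ g c) := by
  have hB : PolyBdd fun c => (f c + 1) ^ g c := (hf.polyBdd_nat.add_const 1).pow_par h hgh
  refine (iterate_of_bdd (st := fun c s => s * f c) hg (const 1) (arg.mul hf.wk)
    ((hB.add hB).add_const 1) fun c k hk => ?_).congr fun c => by simp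
  have h₁ : f c ^ k ≤ (f c + 1) ^ g c :=
    (Nat.pow_le_pow_left (by omega) _).trans (Nat.pow_le_pow_right (by omega) hk)
  simp only [mul_right_iterate, one_mul, sz_nat]
  omega

theorem isNil {d : Γ → Data} (hd : PT d) : PT (fun c => (d c).isNil) := by
  obtain ⟨P, T, hT, -, hr⟩ := hd
  refine ⟨.ite P .leaf (.pair .leaf .leaf), fun c => T c + 4, hT.add_const 4,
    (PolyBdd.const 3).mono fun c => sz_bool_le _, fun c => ?_⟩
  obtain ⟨t, ht, h⟩ := hr c
  cases hd : d c with
  | nil =>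
    rw [hd] at h
    simp only [hd]
    exact ⟨t + 3 + 1, by omega, .ite_false h (.pair (.leaf _) (.leaf _))⟩
  | cons a b =>
    rw [hd] at h
    simp only [hd]
    exact ⟨t + 1 + 1, by omega, .ite_true h (.leaf _)⟩

/-- In unary, zero is the leaf, so truncated subtraction followed by the leaf test decides the
order. -/
theorem decide_le {f g : Γ → ℕ} (hf : PT f) (hg : PT g) : PT (fun c => decide (f c ≤ g c)) := by
  have h : PT fun c => (enc (f c - g c) : Data) := (hf.sub hg).recode fun _ => rfl
  refine h.isNil.congr fun c => ?_
  have h' : f c ≤ g c ↔ f c - g c = 0 := Nat.sub_eq_zero_iff_le.symm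
  simp only [h']
  cases f c - g c with
  | zero => rfl
  | succ n => rfl

theorem decide_lt {f g : Γ → ℕ} (hf : PT f) (hg : PT g) : PT (fun c => decide (f c < g c)) :=
  hf.succ.decide_le hg

theorem range {n : Γ → ℕ} (hn : PT n) : PT (fun c => List.range (n c)) := by
  have h : ∀ k : ℕ, (fun s : ℕ × List ℕ => (s.1 + 1, s.1 :: s.2))^[k] (0, []) =
      (k, (List.range k).reverse) := by
    intro k
    induction k with
    | zero => rfl
    | succ k ih => rw [Function.iterate_succ_apply', ih, List.range_succ]; simp
  have hsz : ∀ k : ℕ, sz (List.range k) ≤ k * (2 * k + 2) + 1 := by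
    intro k
    induction k with
    | zero => simp
    | succ k ih =>
      have := sz_append (List.range k) [k]
      rw [List.range_succ]
      simp only [sz_cons, sz_nil, sz_nat] at this
      nlinarith
  have hn' := hn.polyBdd_nat
  refine (iterate_of_bdd (st := fun (_ : Γ) (s : ℕ × List ℕ) => (s.1 + 1, s.1 :: s.2)) hn
    (const (0, [])) (arg.fst.succ.pair (arg.fst.cons arg.snd))
    (B := fun c => n c * (2 * n c + 2) + 1 + (2 * n c + 2))
    (((hn'.mul (((PolyBdd.const 2).mul hn').add_const 2)).add_const 1).add
      (((PolyBdd.const 2).mul hn').add_const 2)) fun c k hk => ?_).snd.reverse.congr fun c => ?_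
  · rw [h, sz_pair, sz_reverse, sz_nat]
    have h₁ := hsz k
    have h₂ : k * (2 * k + 2) ≤ n c * (2 * n c + 2) := by gcongr
    omega
  · rw [h]; simp

theorem countP {l : Γ → List α} {p : Γ → α → Bool} (hl : PT l)
    (hp : PT fun d : Γ × α => p d.1 d.2) : PT (fun c => (l c).countP (p c)) := by
  refine (foldl_add (st := fun c s a => if p c a = true then s + 1 else s) hl (const 0)
    ((hp.comp (env.fst.pair arg) fun _ => rfl).ite env.snd.succ env.snd) (.const 2)
    fun c s a _ => ?_).congr fun c => by simp [countP_eq_foldl]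
  split <;> simp only [sz_nat] <;> omega

theorem length {l : Γ → List α} (hl : PT l) : PT (fun c => (l c).length) :=
  (hl.countP (p := fun _ _ => true) (const true)).congr fun c => by simp

theorem sum_map {l : Γ → List α} {f : Γ → α → ℕ} (hl : PT l)
    (hf : PT fun d : Γ × α => f d.1 d.2) : PT (fun c => ((l c).map (f c)).sum) := by
  obtain ⟨E, hE, hE'⟩ := hf.polyBdd.exists_bound hl.polyBdd
  refine (foldl_add (st := fun c s a => s + f c a) hl (const 0)
    (env.snd.add (hf.comp (env.fst.pair arg) fun _ => rfl)) hE fun c s a ha => ?_).congr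
    fun c => by simp [foldl_add_map]
  have := hE' c a (sz_le_of_mem ha)
  simp only [sz_nat] at this ⊢
  omega

theorem div {f g : Γ → ℕ} (hf : PT f) (hg : PT g) : PT (fun c => f c / g c) := by
  -- Division by `0` gives `0`, whereas the count would give `f c`; hence the separate case.
  refine ((hg.decide_le (const 0)).ite (const 0) (hf.range.countP
    (p := fun c i => decide ((i + 1) * g c ≤ f c))
    ((arg.succ.mul hg.wk).decide_le hf.wk))).congr fun c => ?_
  rcases Nat.eq_zero_or_pos (g c) with h | h
  · simp [h]
  · rw [countP_range_mul_le _ _ h, if_neg (by simpa using h.ne')]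

theorem mod {f g : Γ → ℕ} (hf : PT f) (hg : PT g) : PT (fun c => f c % g c) :=
  (hf.sub (hg.mul (hf.div hg))).congr fun _ => Nat.mod_eq_sub _ _

/-- Conversion from unary to binary. -/
theorem bits {f : Γ → ℕ} (hf : PT f) : PT (fun c => (f c).bits) := by
  let st : ℕ × List Bool → ℕ × List Bool := fun s =>
    if decide (s.1 ≤ 0) = true then s else (s.1 / 2, decide (1 ≤ s.1 % 2) :: s.2)
  -- Halving reaches `0` within `m` rounds and further rounds change nothing, so `m` itself can be
  -- the number of rounds.
  have h : ∀ k m l, m ≤ k → st^[k] (m, l) = (0, m.bits.reverse ++ l) := by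
    intro k
    induction k with
    | zero => intro m l h; obtain rfl : m = 0 := by omega
              simp
    | succ k ih =>
      intro m l h
      rw [Function.iterate_succ_apply]
      rcases Nat.eq_zero_or_pos m with rfl | hm
      · rw [show st (0, l) = (0, l) from rfl, ih 0 l (by omega)]
      · rw [show st (m, l) = (m / 2, decide (1 ≤ m % 2) :: l) from if_neg (by simpa using hm.ne'),
          ih _ _ (by omega)]
        have hb : m.bits = decide (1 ≤ m % 2) :: (m / 2).bits := by
          conv_lhs => rw [← Nat.bit_bodd_div2 m]
          rw [Nat.bits_append_bit, Nat.div2_val, Nat.bodd_eq_one_and_ne_zero]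
          · congr 1
            rw [Nat.and_comm, Nat.and_one_is_mod]
            rcases Nat.mod_two_eq_zero_or_one m with h | h <;> simp [h]
          · intro h0
            have := Nat.bit_bodd_div2 m
            rw [h0] at this
            cases hb : m.bodd
            · rw [hb] at this; simp at this; omega
            · rfl
        rw [hb]
        simp
  have hst : PT fun d : Γ × (ℕ × List Bool) => st d.2 :=
    (arg.fst.decide_le (const 0)).ite arg
      ((arg.fst.div (const 2)).pair (((const 1).decide_le (arg.fst.mod (const 2))).cons arg.snd))
  refine (iterate (st := fun (_ : Γ) s => st s) hf (hf.pair (const [])) hst (.const 4)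
    fun c s => ?_).snd.reverse.congr fun c => ?_
  · obtain ⟨m, l⟩ := s
    simp only [st]
    split
    · omega
    · have := sz_bool_le (decide (1 ≤ m % 2))
      simp only [sz_pair, sz_nat, sz_cons]
      omega
  · simp [h (f c) (f c) [] le_rfl]

end PT

/-! ### The computations of the algorithm -/

/-- An approximation of `N² exp (-m / N)`. -/
def decay (N m : ℕ) : ℕ := (fun s => s - s / N)^[m] (N * N)

/-- One step of the comparison of `i * a` with `N * b` for binary numbers `a`, `b`. -/
def cmpStep (i N : ℕ) (s : ℕ × (List Bool × List Bool)) : ℕ × (List Bool × List Bool) :=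
  ((s.1 + (if s.2.1.headI = true then 0 else i) + (if s.2.2.headI = true then N else 0)) / 2,
    (s.2.1.tail, s.2.2.tail))

/-- The test whether `i * a ≤ N * b` for binary numbers `a`, `b`. -/
def mulLeMul (i N : ℕ) (a b : List Bool) : Bool :=
  decide (i ≤ ((cmpStep i N)^[a.length + b.length] (i, (a, b))).1)

/-- The minimum of `N²` and the integral part of `N * q`. -/
def gridFloor (N : ℕ) (q : ℚ≥0) : ℕ :=
  (List.range (N * N)).countP fun i => mulLeMul (i + 1) N q.den.bits q.num.bits

/-- An approximation of `N³ E[exp (-κ X)]`, where `X` has the distribution `d`. -/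
def laplaceApprox (N κ : ℕ) (d : Dist) : ℕ :=
  (d.atoms.map fun a => gridFloor N a.2 * decay N (κ * gridFloor N a.1)).sum

/-- An approximation of `-N log E[exp (-κ X)]`, where `X` has the distribution `d`. -/
def logWeight (N κ : ℕ) (d : Dist) : ℕ :=
  (List.range (N * N + 1)).countP fun u => decide (laplaceApprox N κ d < N * decay N u)

/-- A step in the evaluation of the objective: a term `(κ, c⁺, c⁻)` stands for
`(c⁺ - c⁻) exp (-κ x)`, and the next digit of the number in the state is used. -/
def scoreStep (B N : ℕ) (s : ℕ × (ℕ × ℕ)) (t : ℕ × (ℕ × ℕ)) : ℕ × (ℕ × ℕ) :=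
  (s.1 / B, (s.2.1 + t.2.1 * decay N (s.1 % B), s.2.2 + t.2.2 * decay N (s.1 % B)))

/-- The positive and the negative part of the approximate objective, read off from the digits of
`K` to base `B`. -/
def score (B N : ℕ) (terms : List (ℕ × (ℕ × ℕ))) (K : ℕ) : ℕ × ℕ :=
  (terms.foldl (scoreStep B N) (K, (0, 0))).2

/-- The value of a binary number. -/
def bitsVal : List Bool → ℕ
  | [] => 0
  | b :: l => b.toNat + 2 * bitsVal l

/-! ### Correctness of the elementary computations -/

theorem bitsVal_bits (n : ℕ) : bitsVal n.bits = n := by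
  induction n using Nat.binaryRec' with
  | zero => simp [bitsVal]
  | bit b n h ih =>
    rw [Nat.bits_append_bit n b h, bitsVal, ih, Nat.bit_val]
    omega

theorem bitsVal_eq (l : List Bool) : bitsVal l = l.headI.toNat + 2 * bitsVal l.tail := by
  cases l <;> rfl

/-- The numbers `a`, `b` may be exponentially large, so no product is formed. Writing `a = a₀ +
2a'`, `b = b₀ + 2b'`, the inequality `i a + i ≤ N b + s` is equivalent to the same one for `a'`,
`b'` with carry `⌊(s + i - i a₀ + N b₀) / 2⌋`. The extra `i` on the left keeps the carry a natural
number; starting from `s = i` it cancels. -/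
theorem le_cmpStep_iterate (i N k : ℕ) : ∀ (s : ℕ) (a b : List Bool), a.length ≤ k →
    b.length ≤ k → (i ≤ ((cmpStep i N)^[k] (s, (a, b))).1 ↔
      i * bitsVal a + i ≤ N * bitsVal b + s) := by
  induction k with
  | zero =>
    intro s a b ha hb
    obtain rfl := List.length_eq_zero_iff.1 (Nat.le_zero.1 ha)
    obtain rfl := List.length_eq_zero_iff.1 (Nat.le_zero.1 hb)
    simp [bitsVal]
  | succ k ih =>
    intro s a b ha hb
    rw [Function.iterate_succ_apply]
    refine (ih _ a.tail b.tail (by rw [List.length_tail]; omega)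
      (by rw [List.length_tail]; omega)).trans ?_
    rw [bitsVal_eq a, bitsVal_eq b, Nat.mul_add, Nat.mul_add, Nat.mul_left_comm i 2,
      Nat.mul_left_comm N 2]
    generalize i * bitsVal a.tail = x
    generalize N * bitsVal b.tail = y
    cases a.headI <;> cases b.headI <;> simp <;> omega

theorem mulLeMul_bits (i N a b : ℕ) : mulLeMul i N a.bits b.bits = decide (i * a ≤ N * b) := by
  unfold mulLeMul
  rw [decide_eq_decide, le_cmpStep_iterate _ _ _ _ _ _ (by omega) (by omega), bitsVal_bits,
    bitsVal_bits]
  omega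

theorem countP_range_of_initial (p : ℕ → Bool) (m : ℕ) (hp : ∀ i, p i = decide (i < m)) (n : ℕ) :
    (List.range n).countP p = min n m := by
  induction n with
  | zero => simp
  | succ n ih =>
    rw [List.range_succ, List.countP_append, ih, List.countP_singleton, hp]
    by_cases h : n < m
    · simp only [h, decide_true, if_true]; omega
    · simp only [h, decide_false, Bool.false_eq_true, if_false]; omega

/-- The cap keeps the unary result polynomial. It only affects `q > N`, where `exp (-κ q)` is
negligible for `κ ≥ 1`. -/
theorem gridFloor_eq (N : ℕ) (q : ℚ≥0) : gridFloor N q = min (N * N) ⌊N * q⌋₊ := by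
  refine countP_range_of_initial _ _ (fun i => ?_) _
  rw [mulLeMul_bits, decide_eq_decide, Nat.lt_iff_add_one_le, Nat.le_floor_iff (by positivity)]
  have hd : (0 : ℚ≥0) < q.den := by exact_mod_cast q.den_pos
  have hq : q * q.den = q.num := NNRat.mul_den_eq_num q
  rw [← mul_le_mul_iff_left₀ hd, mul_assoc, hq]
  norm_cast

theorem decay_succ (N m : ℕ) : decay N (m + 1) = decay N m - decay N m / N := by
  unfold decay
  rw [Function.iterate_succ_apply']

theorem decay_antitone (N : ℕ) : Antitone (decay N) :=
  antitone_nat_of_succ_le fun m => by rw [decay_succ]; exact Nat.sub_le _ _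

theorem decay_zero (N : ℕ) : decay N 0 = N * N := rfl

theorem decay_le (N m : ℕ) : decay N m ≤ N * N := decay_antitone N (Nat.zero_le m)

theorem logWeight_le (N κ : ℕ) (d : Dist) : logWeight N κ d ≤ N * N + 1 := by
  refine List.countP_le_length.trans ?_
  rw [List.length_range]

/-- The objective can thus be evaluated from the target alone, without knowledge of the set: as all
digits are below `B`, remainder and quotient recover them one by one. -/
theorem score_ofDigits (B N : ℕ) (v : ℕ × (ℕ × ℕ) → ℕ) (hv : ∀ t, v t < B)
    (terms : List (ℕ × (ℕ × ℕ))) (P M : ℕ) :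
    (terms.foldl (scoreStep B N) (Nat.ofDigits B (terms.map v), (P, M))).2 =
      (P + (terms.map fun t => t.2.1 * decay N (v t)).sum,
        M + (terms.map fun t => t.2.2 * decay N (v t)).sum) := by
  induction terms generalizing P M with
  | nil => rfl
  | cons t l ih =>
    have hB : 0 < B := (Nat.zero_le _).trans_lt (hv t)
    have h₁ : (v t + B * Nat.ofDigits B (l.map v)) / B = Nat.ofDigits B (l.map v) := by
      rw [Nat.add_mul_div_left _ _ hB, Nat.div_eq_of_lt (hv t), zero_add]
    have h₂ : (v t + B * Nat.ofDigits B (l.map v)) % B = v t := by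
      rw [Nat.add_mul_mod_self_left, Nat.mod_eq_of_lt (hv t)]
    simp only [List.map_cons, List.foldl_cons, Nat.ofDigits_cons, scoreStep, h₁, h₂, ih,
      List.sum_cons, Nat.add_assoc]

/-! ### Polynomial time of these computations -/

namespace PT

variable {Γ : Type} [Coded Γ] [Env Γ]

theorem decay {N m : Γ → ℕ} (hN : PT N) (hm : PT m) : PT (fun c => decay (N c) (m c)) :=
  iterate (st := fun c s => s - s / N c) hm (hN.mul hN) (arg.sub (arg.div hN.wk)) (.const 0)
    fun c s => by have := Nat.sub_le s (s / N c); simp only [sz_nat]; omega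

theorem mulLeMul {i N : Γ → ℕ} {a b : Γ → List Bool} (hi : PT i) (hN : PT N) (ha : PT a)
    (hb : PT b) : PT (fun c => mulLeMul (i c) (N c) (a c) (b c)) := by
  refine hi.decide_le (iterate (st := fun c s => cmpStep (i c) (N c) s) (ha.length.add hb.length)
    (hi.pair (ha.pair hb)) (.pair (.div (.add (.add arg.fst (.ite arg.snd.fst.headI (const 0) hi.wk))
      (.ite arg.snd.snd.headI hN.wk (const 0))) (const 2)) (.pair arg.snd.fst.tail arg.snd.snd.tail))
    (D := fun c => 2 * i c + 2 * N c) ?_ ?_).fst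
  · exact ((PolyBdd.const 2).mul hi.polyBdd_nat).add ((PolyBdd.const 2).mul hN.polyBdd_nat)
  · rintro c ⟨s, a, b⟩
    have h : ∀ l : List Bool, sz l.tail ≤ sz l := by
      intro l
      cases l with
      | nil => simp
      | cons b l => simp only [List.tail_cons, sz_cons]; omega
    have h₁ := h a
    have h₂ := h b
    simp only [cmpStep, sz_pair, sz_nat]
    split <;> split <;> omega

theorem ratNum {q : Γ → ℚ≥0} (hq : PT q) : PT (fun c => (q c).num.bits) := by
  have h : PT fun c => ((q c).num.bits, (q c).den.bits) := hq.recode fun _ => rfl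
  exact h.fst

theorem ratDen {q : Γ → ℚ≥0} (hq : PT q) : PT (fun c => (q c).den.bits) := by
  have h : PT fun c => ((q c).num.bits, (q c).den.bits) := hq.recode fun _ => rfl
  exact h.snd

theorem gridFloor {N : Γ → ℕ} {q : Γ → ℚ≥0} (hN : PT N) (hq : PT q) :
    PT (fun c => gridFloor (N c) (q c)) :=
  (hN.mul hN).range.countP (mulLeMul arg.succ hN.wk hq.ratDen.wk hq.ratNum.wk)

theorem atoms {d : Γ → Dist} (hd : PT d) : PT (fun c => (d c).atoms) := hd.recode fun _ => rfl

theorem laplaceApprox {N κ : Γ → ℕ} {d : Γ → Dist} (hN : PT N) (hκ : PT κ) (hd : PT d) :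
    PT (fun c => laplaceApprox (N c) (κ c) (d c)) :=
  hd.atoms.sum_map ((hN.wk.gridFloor arg.snd).mul
    (hN.wk.decay (hκ.wk.mul (hN.wk.gridFloor arg.fst))))

theorem logWeight {N κ : Γ → ℕ} {d : Γ → Dist} (hN : PT N) (hκ : PT κ) (hd : PT d) :
    PT (fun c => logWeight (N c) (κ c) (d c)) :=
  (hN.mul hN).succ.range.countP ((laplaceApprox hN hκ hd).wk.decide_lt
    (hN.wk.mul (hN.wk.decay arg)))

theorem score {B N K : Γ → ℕ} {terms : Γ → List (ℕ × (ℕ × ℕ))} (hB : PT B) (hN : PT N)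
    (ht : PT terms) (hK : PT K) : PT (fun c => score (B c) (N c) (terms c) (K c)) := by
  have hd : PT fun d : (Γ × (ℕ × (ℕ × ℕ))) × (ℕ × (ℕ × ℕ)) =>
      StochOpt.decay (N d.1.1) (d.1.2.1 % B d.1.1) := hN.wk.wk.decay (env.snd.fst.mod hB.wk.wk)
  refine (foldl_add (st := fun c s t => scoreStep (B c) (N c) s t) ht (hK.pair (const (0, 0)))
    (.pair (env.snd.fst.div hB.wk.wk) (.pair (env.snd.snd.fst.add (arg.snd.fst.mul hd))
      (env.snd.snd.snd.add (arg.snd.snd.mul hd))))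
    -- Coefficients are unary, hence at most `sz (terms c)`. Each of the two accumulators grows by
    -- at most that times `N²`, and the unary size doubles it.
    (D := fun c => 4 * (sz (terms c) * (N c * N c)))
    ((PolyBdd.const 4).mul (ht.polyBdd.mul (hN.polyBdd_nat.mul hN.polyBdd_nat))) ?_).snd
  rintro c ⟨k, p, m⟩ ⟨κ, a, b⟩ h
  have hs := sz_le_of_mem h
  have h₁ := Nat.div_le_self k (B c)
  simp only [sz_pair, sz_nat] at hs
  have ha : a * StochOpt.decay (N c) (k % B c) ≤ sz (terms c) * (N c * N c) :=
    Nat.mul_le_mul (by omega) (decay_le _ _)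
  have hb : b * StochOpt.decay (N c) (k % B c) ≤ sz (terms c) * (N c * N c) :=
    Nat.mul_le_mul (by omega) (decay_le _ _)
  simp only [scoreStep, sz_pair, sz_nat]
  omega

/-- The number of digits is bounded in terms of the parameter, so the value is polynomial and fits
in unary. -/
theorem ofDigits {B : Γ → ℕ} {l : Γ → List ℕ} (hB : PT B) (hl : PT l) (h : ℚ≥0 → ℕ)
    (hlen : ∀ c, (l c).length ≤ h (par c)) : PT (fun c => Nat.ofDigits (B c) (l c)) := by
  have key : ∀ (b S : ℕ) (l : List ℕ), (∀ a ∈ l, a ≤ S) →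
      l.foldr (fun a s => a + b * s) 0 ≤ S * (b + 1) ^ l.length := by
    intro b S l
    induction l with
    | nil => intro _; simp
    | cons a l ih =>
      intro hl
      have h₁ := ih fun a ha => hl a (by simp [ha])
      have h₂ := hl a (by simp)
      have h₃ : S ≤ S * (b + 1) ^ l.length := Nat.le_mul_of_pos_right _ (by positivity)
      have h₄ := Nat.mul_le_mul_left b h₁
      simp only [List.foldr_cons, List.length_cons, pow_succ]
      calc _ ≤ S * (b + 1) ^ l.length + b * (S * (b + 1) ^ l.length) := by omega
        _ = _ := by ring
  have hbd : PolyBdd fun c => sz (l c) * (B c + 1) ^ (l c).length :=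
    hl.polyBdd.mul ((hB.polyBdd_nat.add_const 1).pow_par h hlen)
  refine (foldl (st := fun c s a => a + B c * s) hl.reverse (const 0)
    (arg.add (hB.wk.wk.mul env.snd)) ((hbd.add hbd).add_const 1) fun c l₁ hp => ?_).congr
    fun c => ?_
  · have h₁ := key (B c) (sz (l c)) l₁.reverse fun a ha => by
      have := hp.subset (List.mem_reverse.1 ha)
      have := sz_le_of_mem (List.mem_reverse.1 this)
      rw [sz_nat] at this
      omega
    have h₂ : l₁.length ≤ (l c).length := by simpa using hp.length_le
    have h₃ := Nat.mul_le_mul_left (sz (l c))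
      (Nat.pow_le_pow_right (Nat.succ_pos (B c)) h₂)
    rw [List.foldr_reverse, List.length_reverse] at h₁
    rw [sz_nat]
    simp only [Nat.succ_eq_add_one] at h₃
    omega
  · rw [List.foldl_reverse, Nat.ofDigits_eq_foldr]
    rfl

end PT

/-! ### The algorithm -/

/-- An input of the algorithm: a parameter and an instance with distributions of the weights. -/
structure Input (A : Problem) : Type where
  /-- The parameter. -/
  ε : ℚ≥0
  /-- The instance. -/
  x : Data
  /-- The tree `x` is an instance. -/
  isInstance : A.IsInstance x
  /-- The distributions of the weights. -/
  π : Fin (A.card x) → Dist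

instance (A : Problem) : Coded (Input A) := ⟨fun c => .cons (encRat c.ε) (encStoch c.x c.π)⟩
instance (A : Problem) : Env (Input A) := ⟨fun c => c.ε⟩

/-- A bound on the size of the ground set and on the numbers of atoms. -/
def spread (l : List Dist) : ℕ := (l.map fun d => d.atoms.length + 1).sum + 1

/-- The weight of an element in the exact problem: the digits to base `B` are the approximate
logarithms of the expectations that occur in the objective. -/
def exactWeight (B N : ℕ) (terms : List (ℕ × (ℕ × ℕ))) (d : Dist) : ℕ :=
  Nat.ofDigits B (terms.map fun t => logWeight N t.1 d)

/-- The better one of two candidates, each given by an answer of the exact algorithm and the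
positive and the negative part of its value. -/
def better (s r : Data × (ℕ × ℕ)) : Data × (ℕ × ℕ) :=
  if r.1.isNil = true then s else if s.1.isNil = true then r else
    if decide (s.2.1 + r.2.2 < r.2.1 + s.2.2) = true then r else s

/-- The approximate objective, up to a factor `N²`. -/
def approxObj {n : ℕ} (N : ℕ) (terms : List (ℕ × (ℕ × ℕ))) (π : Fin n → Dist)
    (S : Finset (Fin n)) : ℤ :=
  (terms.map fun t => ((t.2.1 : ℤ) - t.2.2) * decay N (∑ b ∈ S, logWeight N t.1 (π b))).sum

theorem PT.better {Γ : Type} [Coded Γ] [Env Γ] {s r : Γ → Data × (ℕ × ℕ)} (hs : PT s) (hr : PT r) :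
    PT (fun c => better (s c) (r c)) :=
  .ite hr.fst.isNil hs (.ite hs.fst.isNil hr
    (.ite ((hs.snd.fst.add hr.snd.snd).decide_lt (hr.snd.fst.add hs.snd.snd)) hr hs))

/-- A leaf as first component marks a candidate without solution, including the initial state.
Differences of positive and negative parts are compared by cross addition. -/
theorem foldl_better {α : Type} (f : α → Data × (ℕ × ℕ)) (l : List α) :
    ((∀ a ∈ l, (f a).1.isNil = true) ∧
      l.foldl (fun s a => better s (f a)) (.nil, (0, 0)) = (.nil, (0, 0))) ∨
    ∃ a ∈ l, (f a).1.isNil = false ∧ l.foldl (fun s a => better s (f a)) (.nil, (0, 0)) = f a ∧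
      ∀ b ∈ l, (f b).1.isNil = false →
        ((f b).2.1 : ℤ) - (f b).2.2 ≤ ((f a).2.1 : ℤ) - (f a).2.2 := by
  induction l using List.reverseRecOn with
  | nil => left; simp
  | append_singleton l r ih =>
    rw [List.foldl_append, List.foldl_cons, List.foldl_nil]
    rcases ih with ⟨h₁, h₂⟩ | ⟨a, ha, h₁, h₂, h₃⟩
    · rw [h₂]
      cases hr : (f r).1.isNil with
      | true =>
        left
        refine ⟨fun a ha => ?_, if_pos hr⟩
        rcases List.mem_append.1 ha with ha | ha
        · exact h₁ a ha
        · rw [List.mem_singleton.1 ha, hr]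
      | false =>
        right
        refine ⟨r, by simp, hr, ?_, fun b hb hb' => ?_⟩
        · unfold better
          rw [hr]
          rfl
        · rcases List.mem_append.1 hb with hb | hb
          · simp [h₁ b hb] at hb'
          · rw [List.mem_singleton.1 hb]
    · rw [h₂]
      right
      cases hr : (f r).1.isNil with
      | true =>
        refine ⟨a, by simp [ha], h₁, if_pos hr, fun b hb hb' => ?_⟩
        rcases List.mem_append.1 hb with hb | hb
        · exact h₃ b hb hb'
        · rw [List.mem_singleton.1 hb, hr] at hb'
          simp at hb'
      | false =>
        by_cases hlt : (f a).2.1 + (f r).2.2 < (f r).2.1 + (f a).2.2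
        · refine ⟨r, by simp, hr, by simp [better, hr, h₁, hlt], fun b hb hb' => ?_⟩
          rcases List.mem_append.1 hb with hb | hb
          · have := h₃ b hb hb'
            omega
          · rw [List.mem_singleton.1 hb]
        · refine ⟨a, by simp [ha], h₁, by simp [better, hr, h₁, hlt], fun b hb hb' => ?_⟩
          rcases List.mem_append.1 hb with hb | hb
          · exact h₃ b hb hb'
          · rw [List.mem_singleton.1 hb]
            omega

/-- `Nat.ofDigits` is linear in the digits whether or not they stay below `B`; the absence of
carries matters only when the digits are read back. -/
theorem sum_ofDigits {ι τ : Type} (B : ℕ) (v : ι → τ → ℕ) (S : Finset ι) (terms : List τ) :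
    ∑ b ∈ S, Nat.ofDigits B (terms.map (v b)) =
      Nat.ofDigits B (terms.map fun t => ∑ b ∈ S, v b t) := by
  induction terms with
  | nil => simp
  | cons t l ih =>
    simp only [List.map_cons, Nat.ofDigits_cons, Finset.sum_add_distrib, ← Finset.mul_sum, ih]

theorem polyBdd_polynomial {Γ : Type} [Coded Γ] [Env Γ] (p : Polynomial ℕ) {f : Γ → ℕ}
    (hf : PolyBdd f) : PolyBdd fun c => p.eval (f c) := by
  induction p using Polynomial.induction_on' with
  | add p q hp hq => simpa using hp.add hq
  | monomial n a =>
    simp only [Polynomial.eval_monomial]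
    exact (PolyBdd.const a).mul (hf.pow_par (fun _ => n) fun _ => le_rfl)

theorem size_encAnswer_le {n : ℕ} (S : Option (Finset (Fin n))) :
    (encAnswer S).size ≤ 4 * n + 3 := by
  have h : ∀ l : List Bool, (encList encBool l).size ≤ 4 * l.length + 1 := by
    intro l
    induction l with
    | nil => simp [encList, Data.size]
    | cons b l ih =>
      have := sz_bool_le b
      simp only [encList, Data.size, List.length_cons]
      simp only [sz, enc] at this
      omega
  cases S with
  | none => simp [encAnswer, Data.size]
  | some S =>
    have := h (List.ofFn fun i => decide (i ∈ S))
    rw [List.length_ofFn] at this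
    simp only [encAnswer, encSet, Data.size]
    omega

/-! ### The exact algorithm and the search over all targets -/

variable {A : Problem}

theorem PT.fields : PT (fun c : Input A => (c.ε, (c.x, List.ofFn c.π))) := id.recode fun _ => rfl

theorem PT.dists : PT (fun c : Input A => List.ofFn c.π) := fields.snd.snd

theorem PT.param : PT (fun c : Input A => c.ε) := fields.fst

theorem PT.inst : PT (fun c : Input A => c.x) := fields.snd.fst

theorem PT.spread : PT (fun c : Input A => spread (List.ofFn c.π)) :=
  (dists.sum_map arg.atoms.length.succ).succ

theorem PT.card : PT (fun c : Input A => A.card c.x) :=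
  dists.length.congr fun c => by simp

/-- The exact algorithm, applied to weights and a target that are computed from the input. -/
theorem exists_exact (hA : A.ExactPseudoPoly) (w : Input A → Dist → ℕ)
    (hw : PT fun d : Input A × Dist => w d.1 d.2) :
    ∃ ex : Input A → ℕ → Data, PT (fun d : Input A × ℕ => ex d.1 d.2) ∧ ∀ c K,
      (∃ S, A.Feasible c.x S ∧ ∑ b ∈ S, w c (c.π b) = K ∧ ex c K = encAnswer (some S)) ∨
      ((¬ ∃ S, A.Feasible c.x S ∧ ∑ b ∈ S, w c (c.π b) = K) ∧
        ex c K = encAnswer (n := A.card c.x) none) := by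
  obtain ⟨P, p, hP⟩ := hA
  choose out t hrun ht hout using hP
  have hmap : PT fun c : Input A => (List.ofFn c.π).map fun b => (w c b).bits :=
    PT.map (f := fun c b => (w c b).bits) PT.dists hw.bits
  have hW : PT fun d : Input A × ℕ =>
      (d.1.x, (((List.ofFn d.1.π).map fun b => (w d.1 b).bits), d.2.bits)) :=
    PT.inst.wk.pair (hmap.wk.pair PT.arg.bits)
  have henc : ∀ d : Input A × ℕ, enc
      (d.1.x, (((List.ofFn d.1.π).map fun b => (w d.1 b).bits), d.2.bits)) =
      .cons d.1.x (.cons (encList encNat (List.ofFn fun b => w d.1 (d.1.π b))) (encNat d.2)) := by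
    intro d
    refine congrArg (fun l => Data.cons d.1.x (.cons l (encNat d.2))) ?_
    have : ∀ l : List Dist, enc (l.map fun b => (w d.1 b).bits) =
        encList encNat (l.map (w d.1)) := by
      intro l
      induction l with
      | nil => rfl
      | cons a l ih => exact congrArg (Data.cons _) ih
    refine (this _).trans ?_
    rw [List.map_ofFn]
    rfl
  refine ⟨fun c K => out c.x c.isInstance (fun b => w c (c.π b)) K, ?_,
    fun c K => hout c.x c.isInstance (fun b => w c (c.π b)) K⟩
  have hs := hW.polyBdd
  obtain ⟨P', T, hT, -, hr⟩ := hW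
  -- The target is held in unary, so the pseudopolynomial bound is polynomial in the size of the
  -- context.
  refine ⟨.seq P' P, fun d => T d + p.eval (sz (d.1.x,
    (((List.ofFn d.1.π).map fun b => (w d.1 b).bits), d.2.bits)) + d.2) + 1,
    (hT.add (polyBdd_polynomial p (hs.add PT.arg.polyBdd_nat))).add_const 1, ?_, fun d => ?_⟩
  · have hc : PolyBdd fun d : Input A × ℕ => 4 * A.card d.1.x + 3 :=
      ((PolyBdd.const 4).mul PT.card.wk.polyBdd_nat).add_const 3
    refine hc.mono fun d => ?_
    rcases hout d.1.x d.1.isInstance (fun b => w d.1 (d.1.π b)) d.2 with ⟨S, -, -, h⟩ | ⟨-, h⟩ <;>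
      exact (congrArg Data.size h).trans_le (size_encAnswer_le _)
  · obtain ⟨t', ht', h'⟩ := hr d
    rw [henc] at h'
    refine ⟨_, ?_, .seq h' (hrun d.1.x d.1.isInstance (fun b => w d.1 (d.1.π b)) d.2)⟩
    have := ht d.1.x d.1.isInstance (fun b => w d.1 (d.1.π b)) d.2
    rw [← henc d] at this
    change _ ≤ T d + Polynomial.eval ((enc _).size + _) p + 1
    omega

/-- The algorithm finds a feasible solution with the largest approximate objective. -/
theorem exists_algorithm (hA : A.ExactPseudoPoly) (terms : Input A → List (ℕ × (ℕ × ℕ)))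
    (hterms : PT terms) (h : ℚ≥0 → ℕ) (hlen : ∀ c, (terms c).length ≤ h c.ε)
    (N : Input A → ℕ) (hN : PT N) :
    ∃ out : Input A → Data, PT out ∧ ∀ c,
      (∃ S, A.Feasible c.x S ∧ (∀ S', A.Feasible c.x S' →
        approxObj (N c) (terms c) c.π S' ≤ approxObj (N c) (terms c) c.π S) ∧
        out c = encAnswer (some S)) ∨
      ((¬ ∃ S, A.Feasible c.x S) ∧ out c = encAnswer (n := A.card c.x) none) := by
  -- Every logarithmic weight is at most `N² + 1`, so sums over a set stay below `B`; the `2` also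
  -- makes `B` a genuine base.
  let B : Input A → ℕ := fun c => A.card c.x * (N c * N c + 1) + 2
  have hB : PT B := (PT.card.mul (hN.mul hN).succ).succ.succ
  let w : Input A → Dist → ℕ := fun c d => exactWeight (B c) (N c) (terms c) d
  have hw : PT fun d : Input A × Dist => w d.1 d.2 := by
    refine PT.ofDigits hB.wk (hterms.wk.map ?_) h fun d => ?_
    · exact PT.logWeight hN.wk.wk PT.arg.fst PT.env.snd
    · rw [List.length_map]; exact hlen d.1
  obtain ⟨ex, hex, hspec⟩ := exists_exact hA w hw
  have hsc : PT fun d : Input A × ℕ => score (B d.1) (N d.1) (terms d.1) d.2 :=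
    PT.score hB.wk hN.wk hterms.wk PT.arg
  have hcand := hex.pair hsc
  have hrange : PT fun c : Input A => List.range (B c ^ (terms c).length) :=
    (hB.pow_par hterms.length h hlen).range
  let f : Input A → ℕ → Data × (ℕ × ℕ) := fun c K =>
    (ex c K, score (B c) (N c) (terms c) K)
  obtain ⟨E, hE, hE'⟩ := hcand.polyBdd.exists_bound hrange.polyBdd
  refine ⟨fun c => ((List.range (B c ^ (terms c).length)).foldl (fun s K => better s (f c K))
    (.nil, (0, 0))).1, ?_, fun c => ?_⟩
  · refine (PT.foldl (st := fun c s K => better s (f c K)) hrange (PT.const (.nil, (0, 0)))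
      (PT.env.snd.better (hcand.comp (PT.env.fst.pair PT.arg) fun _ => rfl))
      (hE.add_const 5) fun c l₁ hl => ?_).fst
    rcases foldl_better (f c) l₁ with ⟨-, h⟩ | ⟨K, hK, -, h, -⟩
    · rw [h]
      exact le_add_left le_rfl
    · rw [h]
      have := hE' c K (sz_le_of_mem (hl.subset hK))
      exact this.trans (Nat.le_add_right _ _)
  · have hv : ∀ S : Finset (Fin (A.card c.x)), ∀ t : ℕ × (ℕ × ℕ),
        ∑ b ∈ S, logWeight (N c) t.1 (c.π b) < B c := by
      intro S t
      have h₁ := Finset.sum_le_card_nsmul S (fun b => logWeight (N c) t.1 (c.π b)) (N c * N c + 1)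
        fun b _ => logWeight_le _ _ _
      have h₂ : S.card ≤ A.card c.x := by simpa using S.card_le_univ
      have h₃ := Nat.mul_le_mul_right (N c * N c + 1) h₂
      simp only [smul_eq_mul] at h₁
      simp only [B]
      omega
    have hdig : ∀ S : Finset (Fin (A.card c.x)), ∑ b ∈ S, w c (c.π b) =
        Nat.ofDigits (B c) ((terms c).map fun t => ∑ b ∈ S, logWeight (N c) t.1 (c.π b)) :=
      fun S => by
        simp only [w, exactWeight]
        exact sum_ofDigits (B c) (fun b (t : ℕ × (ℕ × ℕ)) => logWeight (N c) t.1 (c.π b)) S _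
    have hmem : ∀ S : Finset (Fin (A.card c.x)), ∑ b ∈ S, w c (c.π b) ∈
        List.range (B c ^ (terms c).length) := by
      intro S
      rw [List.mem_range, hdig]
      have := Nat.ofDigits_lt_base_pow_length (b := B c)
        (l := (terms c).map fun t => ∑ b ∈ S, logWeight (N c) t.1 (c.π b)) (Nat.le_add_left 2 _)
        (fun a ha => by obtain ⟨t, -, rfl⟩ := List.mem_map.1 ha; exact hv S t)
      simpa using this
    have hval : ∀ S : Finset (Fin (A.card c.x)),
        ((f c (∑ b ∈ S, w c (c.π b))).2.1 : ℤ) - (f c (∑ b ∈ S, w c (c.π b))).2.2 =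
          approxObj (N c) (terms c) c.π S := by
      intro S
      simp only [f]
      rw [hdig, score, score_ofDigits (B c) (N c) _ (hv S)]
      simp only [approxObj, zero_add]
      generalize terms c = l
      induction l with
      | nil => simp
      | cons t l ih =>
        simp only [List.map_cons, List.sum_cons, ← ih]
        push_cast
        ring
    have hnil : ∀ S, A.Feasible c.x S → (f c (∑ b ∈ S, w c (c.π b))).1.isNil = false := by
      intro S hS
      rcases hspec c (∑ b ∈ S, w c (c.π b)) with ⟨S', -, -, h⟩ | ⟨h, -⟩
      · simp only [f]
        rw [h]
        rfl
      · exact absurd ⟨S, hS, rfl⟩ h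
    rcases foldl_better (f c) (List.range (B c ^ (terms c).length)) with
      ⟨h₁, h₂⟩ | ⟨K, hK, h₁, h₂, h₃⟩
    · right
      refine ⟨?_, by simp only [h₂]; rfl⟩
      rintro ⟨S, hS⟩
      have := h₁ _ (hmem S)
      rw [hnil S hS] at this
      simp at this
    · left
      -- Whichever set the exact algorithm returns for the winning target, its approximate objective
      -- is the score, which depends only on its weight.
      rcases hspec c K with ⟨S, hS, rfl, h⟩ | ⟨-, h⟩
      · refine ⟨S, hS, fun S' hS' => ?_, by simp only [h₂]; exact h⟩
        rw [← hval, ← hval]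
        exact h₃ _ (hmem S') (hnil S' hS')
      · simp only [f] at h₁
        rw [h] at h₁
        simp [encAnswer, Data.isNil] at h₁

/-! ### Analysis of the approximation -/

/-- The Laplace transform `E[exp (-κ X)]` of a distribution. -/
noncomputable def Dist.laplace (d : Dist) (κ : ℕ) : ℝ :=
  (d.atoms.map fun a => (a.2 : ℝ) * Real.exp (-(κ * (a.1 : ℝ)))).sum

/-- The expectation of `∑ (c⁺ - c⁻) exp (-κ X(S))`, where the sum is over the terms. -/
noncomputable def exactObj {n : ℕ} (terms : List (ℕ × (ℕ × ℕ))) (π : Fin n → Dist)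
    (S : Finset (Fin n)) : ℝ :=
  (terms.map fun t => ((t.2.1 : ℝ) - t.2.2) * ∏ b ∈ S, (π b).laplace t.1).sum

/-- Each step contracts the old error by `1 - 1/N` and adds `1/N²` from rounding and `1/N²` from
`exp (-1/N) ≈ 1 - 1/N`. Since `(1 - 1/N) * (2/N) + 2/N² = 2/N`, the error does not accumulate. -/
theorem abs_decay_sub_exp_le {N : ℕ} (hN : 0 < N) (m : ℕ) :
    |(decay N m : ℝ) / (N * N) - Real.exp (-(m / N))| ≤ 2 / N := by
  have hN' : (1 : ℝ) ≤ N := by exact_mod_cast hN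
  have h0 : (0 : ℝ) < N := by linarith
  induction m with
  | zero =>
    simp only [decay_zero, Nat.cast_mul, Nat.cast_zero, zero_div, neg_zero, Real.exp_zero]
    rw [div_self (by positivity), sub_self, abs_zero]
    positivity
  | succ m ih =>
    obtain ⟨f, hf0, hf1, hf⟩ : ∃ f : ℝ, 0 ≤ f ∧ f ≤ 1 ∧
        (decay N (m + 1) : ℝ) = decay N m * (1 - 1 / N) + f := by
      refine ⟨(decay N m : ℝ) / N - (decay N m / N : ℕ), ?_, ?_, ?_⟩
      · have := @Nat.cast_div_le ℝ _ _ _ (decay N m) N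
        linarith
      · have : (decay N m : ℝ) / N < (decay N m / N : ℕ) + 1 := by
          rw [div_lt_iff₀ h0]
          exact_mod_cast Nat.lt_mul_of_div_lt (Nat.lt_succ_self _) hN
        linarith
      · rw [decay_succ, Nat.cast_sub (Nat.div_le_self _ _)]
        ring
    have he : |Real.exp (-(1 / N)) - (1 - 1 / N)| ≤ 1 / (N * N) := by
      have h1 : |-(1 / (N : ℝ))| ≤ 1 := by
        rw [abs_neg, abs_of_pos (by positivity), div_le_one h0]; exact hN'
      have := Real.abs_exp_sub_one_sub_id_le h1
      calc _ = |Real.exp (-(1 / N)) - 1 - -(1 / (N : ℝ))| := by congr 1; ring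
        _ ≤ _ := this
        _ = _ := by field_simp
    have hexp : Real.exp (-((m + 1 : ℕ) / N)) = Real.exp (-(m / N)) * Real.exp (-(1 / N)) := by
      rw [← Real.exp_add]; congr 1; push_cast; ring
    have hr : (0 : ℝ) ≤ 1 - 1 / N := by
      rw [sub_nonneg, div_le_one h0]; exact hN'
    have hle : Real.exp (-(m / N)) ≤ 1 := Real.exp_le_one_iff.2 (by
      rw [neg_nonpos]; positivity)
    have hid : (decay N (m + 1) : ℝ) / (N * N) - Real.exp (-((m + 1 : ℕ) / N)) =
        (1 - 1 / N) * ((decay N m : ℝ) / (N * N) - Real.exp (-(m / N))) + f / (N * N) -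
          Real.exp (-(m / N)) * (Real.exp (-(1 / N)) - (1 - 1 / N)) := by
      rw [hf, hexp]; ring
    rw [hid]
    have h1 : |(1 - 1 / (N : ℝ)) * ((decay N m : ℝ) / (N * N) - Real.exp (-(m / N)))| ≤
        (1 - 1 / N) * (2 / N) := by
      rw [abs_mul, abs_of_nonneg hr]
      exact mul_le_mul_of_nonneg_left ih hr
    have h2 : |f / (N * N : ℝ)| ≤ 1 / (N * N) := by
      rw [abs_of_nonneg (by positivity)]
      gcongr
    have h3 : |Real.exp (-(m / N)) * (Real.exp (-(1 / N)) - (1 - 1 / N))| ≤ 1 / (N * N) := by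
      rw [abs_mul, abs_of_nonneg (Real.exp_nonneg _)]
      calc _ ≤ 1 * (1 / (N * N : ℝ)) := by gcongr
        _ = _ := one_mul _
    calc _ ≤ (1 - 1 / (N : ℝ)) * (2 / N) + 1 / (N * N) + 1 / (N * N) :=
          (abs_sub _ _).trans (add_le_add ((abs_add_le _ _).trans (add_le_add h1 h2)) h3)
      _ = 2 / N := by field_simp; ring

theorem exp_neg_nat_le {N : ℕ} (hN : 0 < N) : Real.exp (-(N : ℝ)) ≤ 1 / N := by
  have h0 : (0 : ℝ) < N := by exact_mod_cast hN
  rw [Real.exp_neg, ← one_div]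
  apply one_div_le_one_div_of_le h0
  linarith [Real.add_one_le_exp (N : ℝ)]

theorem exp_neg_sub_exp_neg_le {a b : ℝ} (ha : 0 ≤ a) (hab : a ≤ b) :
    |Real.exp (-b) - Real.exp (-a)| ≤ b - a := by
  have h : Real.exp (-b) ≤ Real.exp (-a) := Real.exp_le_exp.2 (by linarith)
  rw [abs_sub_comm, abs_of_nonneg (by linarith)]
  have h1 : Real.exp (-b) = Real.exp (-a) * Real.exp (-(b - a)) := by
    rw [← Real.exp_add]; congr 1; ring
  have h2 := Real.add_one_le_exp (-(b - a))
  have h3 : Real.exp (-a) ≤ 1 := Real.exp_le_one_iff.2 (by linarith)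
  have h4 := Real.exp_nonneg (-a)
  rw [h1]
  nlinarith

/-- Below the cap the rounding error `1/N` of `q` is multiplied by `κ`. At the cap both exponentials
are at most `1/N`, except for `κ = 0`, where both are `1`. -/
theorem abs_exp_sub_exp_gridFloor_le {N : ℕ} (hN : 0 < N) (κ : ℕ) (q : ℚ≥0) :
    |Real.exp (-(κ * (q : ℝ))) - Real.exp (-((κ * gridFloor N q : ℕ) / N))| ≤ (κ + 1) / N := by
  have h0 : (0 : ℝ) < N := by exact_mod_cast hN
  have hq : (0 : ℝ) ≤ q := by exact_mod_cast q.2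
  rw [gridFloor_eq]
  have hfloor : ((⌊N * q⌋₊ : ℕ) : ℝ) ≤ N * q := by
    exact_mod_cast Nat.floor_le (a := (N * q : ℚ≥0)) (by positivity)
  have hfloor' : (N * q : ℝ) < (⌊N * q⌋₊ : ℕ) + 1 := by
    exact_mod_cast Nat.lt_floor_add_one (N * q : ℚ≥0)
  rcases le_total ⌊N * q⌋₊ (N * N) with h | h
  · rw [min_eq_right h]
    push_cast
    have h1 : (κ * (⌊N * q⌋₊ : ℕ) / N : ℝ) ≤ κ * q := by
      rw [div_le_iff₀ h0]
      calc (κ * (⌊N * q⌋₊ : ℕ) : ℝ) ≤ κ * (N * q) := by gcongr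
        _ = _ := by ring
    refine (exp_neg_sub_exp_neg_le (by positivity) h1).trans ?_
    rw [sub_le_iff_le_add, ← add_div, le_div_iff₀ h0]
    nlinarith [(Nat.cast_nonneg κ : (0 : ℝ) ≤ κ)]
  · rw [min_eq_left h]
    rcases Nat.eq_zero_or_pos κ with rfl | hκ
    · simp
    · have hκ' : (1 : ℝ) ≤ κ := by exact_mod_cast hκ
      have hNq : (N : ℝ) ≤ q := by
        have : ((N * N : ℕ) : ℝ) ≤ N * q := le_trans (by exact_mod_cast h) hfloor
        push_cast at this
        exact le_of_mul_le_mul_left this h0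
      have h1 : Real.exp (-(κ * (q : ℝ))) ≤ 1 / N :=
        (Real.exp_le_exp.2 (by nlinarith)).trans (exp_neg_nat_le hN)
      have h2 : Real.exp (-((κ * (N * N) : ℕ) / (N : ℝ))) ≤ 1 / N := by
        refine (Real.exp_le_exp.2 ?_).trans (exp_neg_nat_le hN)
        rw [neg_le_neg_iff, le_div_iff₀ h0]
        push_cast
        nlinarith [mul_pos h0 h0]
      have h3 : (1 : ℝ) / N ≤ (κ + 1) / N := by gcongr; linarith
      rw [abs_sub_le_iff]
      constructor <;> linarith [Real.exp_nonneg (-(κ * (q : ℝ))),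
        Real.exp_nonneg (-((κ * (N * N) : ℕ) / (N : ℝ)))]

theorem gridFloor_bounds {N : ℕ} (hN : 0 < N) {q : ℚ≥0} (hq : q ≤ 1) :
    (gridFloor N q : ℝ) / N ≤ q ∧ (q : ℝ) - gridFloor N q / N ≤ 1 / N := by
  have h0 : (0 : ℝ) < N := by exact_mod_cast hN
  have hfloor : ((⌊N * q⌋₊ : ℕ) : ℝ) ≤ N * q := by
    exact_mod_cast Nat.floor_le (a := (N * q : ℚ≥0)) (by positivity)
  have hfloor' : (N * q : ℝ) < (⌊N * q⌋₊ : ℕ) + 1 := by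
    exact_mod_cast Nat.lt_floor_add_one (N * q : ℚ≥0)
  have hq' : (q : ℝ) ≤ 1 := by exact_mod_cast hq
  have h : ⌊N * q⌋₊ ≤ N * N := by
    have : ((⌊N * q⌋₊ : ℕ) : ℝ) ≤ N := by nlinarith
    have : ⌊N * q⌋₊ ≤ N := by exact_mod_cast this
    nlinarith
  rw [gridFloor_eq, min_eq_right h]
  constructor
  · rw [div_le_iff₀ h0]; linarith
  · rw [sub_le_iff_le_add, ← add_div, le_div_iff₀ h0]; linarith

theorem Dist.sum_prob_real (d : Dist) : (d.atoms.map fun a => (a.2 : ℝ)).sum = 1 := by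
  have h := congrArg (fun q : ℚ≥0 => (q : ℝ)) d.sum_prob
  have key : ∀ l : List (ℚ≥0 × ℚ≥0),
      (((l.map Prod.snd).sum : ℚ≥0) : ℝ) = (l.map fun a => (a.2 : ℝ)).sum := by
    intro l
    induction l with
    | nil => simp
    | cons a l ih => simp [ih]
  simpa [key] using h

theorem Dist.prob_le_one (d : Dist) {a : ℚ≥0 × ℚ≥0} (ha : a ∈ d.atoms) : a.2 ≤ 1 := by
  rw [← d.sum_prob]
  exact List.single_le_sum (fun _ _ => zero_le) _ (List.mem_map_of_mem ha)

theorem decay_div_le_one {N : ℕ} (hN : 0 < N) (m : ℕ) : (decay N m : ℝ) / (N * N) ≤ 1 := by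
  have h0 : (0 : ℝ) < N := by exact_mod_cast hN
  rw [div_le_one (by positivity)]
  exact_mod_cast decay_le N m

/-- The errors of the exponentials are averaged with total weight one, while rounding the
probabilities costs `1/N` per atom. -/
theorem abs_laplace_sub_le {N : ℕ} (hN : 0 < N) (κ : ℕ) (d : Dist) :
    |d.laplace κ - laplaceApprox N κ d / (N * N * N)| ≤ (κ + 3 + d.atoms.length) / N := by
  have h0 : (0 : ℝ) < N := by exact_mod_cast hN
  have atom : ∀ a ∈ d.atoms, |(a.2 : ℝ) * Real.exp (-(κ * (a.1 : ℝ))) -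
      (gridFloor N a.2 * decay N (κ * gridFloor N a.1) : ℕ) / (N * N * N)| ≤
      (a.2 : ℝ) * ((κ + 3) / N) + 1 / N := by
    intro a ha
    obtain ⟨h1, h2⟩ := gridFloor_bounds hN (d.prob_le_one ha)
    have h3 := abs_exp_sub_exp_gridFloor_le hN κ a.1
    have h4 := abs_decay_sub_exp_le hN (κ * gridFloor N a.1)
    have h5 := decay_div_le_one hN (κ * gridFloor N a.1)
    set e := Real.exp (-(κ * (a.1 : ℝ)))
    set g := Real.exp (-((κ * gridFloor N a.1 : ℕ) / (N : ℝ)))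
    set τ := (decay N (κ * gridFloor N a.1) : ℝ) / (N * N) with hτ
    have hτ0 : 0 ≤ τ := by positivity
    have hp0 : (0 : ℝ) ≤ a.2 := by exact_mod_cast a.2.2
    have h6 : |e - τ| ≤ (κ + 3) / N := by
      calc |e - τ| = |(e - g) - (τ - g)| := by congr 1; ring
        _ ≤ (κ + 1) / N + 2 / N := (abs_sub _ _).trans (add_le_add h3 h4)
        _ = _ := by ring
    have hid : (a.2 : ℝ) * e - (gridFloor N a.2 * decay N (κ * gridFloor N a.1) : ℕ) / (N * N * N)
        = a.2 * (e - τ) + (a.2 - gridFloor N a.2 / N) * τ := by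
      rw [hτ]; push_cast; field_simp; ring
    rw [hid]
    refine (abs_add_le _ _).trans (add_le_add ?_ ?_)
    · rw [abs_mul, abs_of_nonneg hp0]
      exact mul_le_mul_of_nonneg_left h6 hp0
    · rw [abs_of_nonneg (mul_nonneg (by linarith) hτ0)]
      calc _ ≤ 1 / (N : ℝ) * 1 := mul_le_mul h2 h5 hτ0 (by positivity)
        _ = _ := mul_one _
  have hsum := d.sum_prob_real
  have key : ∀ l : List (ℚ≥0 × ℚ≥0), (∀ a ∈ l, a ∈ d.atoms) →
      |(l.map fun a => (a.2 : ℝ) * Real.exp (-(κ * (a.1 : ℝ)))).sum -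
        ((l.map fun a => gridFloor N a.2 * decay N (κ * gridFloor N a.1)).sum : ℕ) /
          (N * N * N)| ≤ (l.map fun a => (a.2 : ℝ)).sum * ((κ + 3) / N) + l.length / N := by
    intro l
    induction l with
    | nil => intro _; simp
    | cons a l ih =>
      intro hl
      have h1 := ih fun a ha => hl a (by simp [ha])
      have h2 := atom a (hl a (by simp))
      simp only [List.map_cons, List.sum_cons, List.length_cons]
      refine le_trans (le_of_eq ?_) ((abs_add_le _ _).trans ((add_le_add h2 h1).trans
        (le_of_eq ?_)))
      · congr 1; push_cast; ring
      · push_cast; ring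
  have := key d.atoms fun _ h => h
  rw [hsum] at this
  refine this.trans (le_of_eq ?_)
  ring

/-- For a downward closed predicate the count is the first failure; this characterizes `logWeight`.
-/
theorem countP_range_antitone (p : ℕ → Bool) (hp : ∀ i j, i ≤ j → p j = true → p i = true)
    (n : ℕ) : (∀ u < (List.range n).countP p, p u = true) ∧
      ((List.range n).countP p < n → p ((List.range n).countP p) = false) := by
  induction n with
  | zero => simp
  | succ n ih =>
    have hle : (List.range n).countP p ≤ n := by simpa using (List.range n).countP_le_length (p := p)
    rw [List.range_succ, List.countP_append, List.countP_singleton]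
    obtain ⟨h1, h2⟩ := ih
    cases hn : p n with
    | true =>
      have : (List.range n).countP p = n := by
        by_contra hne
        have h3 := h2 (by omega)
        rw [hp _ n hle hn] at h3
        simp at h3
      simp only [if_true, this] at h1 ⊢
      refine ⟨fun u hu => ?_, by omega⟩
      rcases Nat.lt_succ_iff_lt_or_eq.1 hu with h | rfl
      · exact h1 u h
      · exact hn
    | false =>
      simp only [Bool.false_eq_true, if_false, add_zero]
      refine ⟨h1, fun _ => ?_⟩
      rcases hle.lt_or_eq with h | h
      · exact h2 h
      · rw [h, hn]

theorem laplaceApprox_le (N κ : ℕ) (hN : 0 < N) (d : Dist) : laplaceApprox N κ d ≤ N * N * N := by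
  have h0 : (0 : ℝ) < N := by exact_mod_cast hN
  have key : ∀ l : List (ℚ≥0 × ℚ≥0), (∀ a ∈ l, a ∈ d.atoms) →
      ((l.map fun a => gridFloor N a.2 * decay N (κ * gridFloor N a.1)).sum : ℝ) ≤
        (l.map fun a => (a.2 : ℝ)).sum * (N * N * N) := by
    intro l
    induction l with
    | nil => intro _; simp
    | cons a l ih =>
      intro hl
      have h1 := ih fun a ha => hl a (by simp [ha])
      have h2 := (gridFloor_bounds hN (d.prob_le_one (hl a (by simp)))).1
      have h3 : (decay N (κ * gridFloor N a.1) : ℝ) ≤ N * N := by exact_mod_cast decay_le _ _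
      rw [div_le_iff₀ h0] at h2
      have hp0 : (0 : ℝ) ≤ a.2 := by exact_mod_cast a.2.2
      have h4 : (gridFloor N a.2 : ℝ) * decay N (κ * gridFloor N a.1) ≤ (a.2 * N) * (N * N) := by
        gcongr
      simp only [List.map_cons, List.sum_cons] at h1 ⊢
      push_cast at h1 ⊢
      linarith
  have := key d.atoms fun _ h => h
  rw [d.sum_prob_real, one_mul] at this
  have h : ((laplaceApprox N κ d : ℕ) : ℝ) ≤ ((N * N * N : ℕ) : ℝ) := by
    push_cast
    exact this
  exact_mod_cast h

/-- If the search stops, `N * decay N v` has just dropped to at most the approximate transform, and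
consecutive values differ by at most `N²`, that is `1/N` after scaling. If it runs to the cap, both
quantities are at most `3/N`. Passing from `decay` to `exp` adds `2/N`. -/
theorem abs_laplaceApprox_sub_le {N : ℕ} (hN : 0 < N) (κ : ℕ) (d : Dist) :
    |(laplaceApprox N κ d : ℝ) / (N * N * N) - Real.exp (-(logWeight N κ d / N))| ≤ 5 / N := by
  have h0 : (0 : ℝ) < N := by exact_mod_cast hN
  have hy := laplaceApprox_le N κ hN d
  obtain ⟨h1, h2⟩ := countP_range_antitone
    (fun u => decide (laplaceApprox N κ d < N * decay N u)) (fun i j hij h => by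
      have := Nat.mul_le_mul_left N (decay_antitone N hij)
      simp only [decide_eq_true_eq] at h ⊢
      omega) (N * N + 1)
  have hv := logWeight_le N κ d
  change ∀ u < logWeight N κ d, _ at h1
  change logWeight N κ d < _ → decide (_ < N * decay N (logWeight N κ d)) = _ at h2
  set v := logWeight N κ d
  set y := laplaceApprox N κ d
  have h3 := abs_decay_sub_exp_le hN v
  suffices h : |(y : ℝ) / (N * N * N) - decay N v / (N * N)| ≤ 3 / N by
    calc |(y : ℝ) / (N * N * N) - Real.exp (-(v / N))| =
        |((y : ℝ) / (N * N * N) - decay N v / (N * N)) +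
          (decay N v / (N * N) - Real.exp (-(v / N)))| := by congr 1; ring
      _ ≤ 3 / N + 2 / N := (abs_add_le _ _).trans (add_le_add h h3)
      _ = 5 / N := by ring
  rcases hv.lt_or_eq with hlt | heq
  · have h4 := h2 hlt
    simp only [decide_eq_false_iff_not, not_lt] at h4
    have h5 : y ≤ N * decay N v + N * N := by
      rcases Nat.eq_zero_or_pos v with h | h
      · rw [h, decay_zero]
        nlinarith
      · obtain ⟨u, hu⟩ : ∃ u, v = u + 1 := ⟨v - 1, by omega⟩
        have h6 := h1 u (by omega)
        simp only [decide_eq_true_eq] at h6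
        rw [hu, decay_succ]
        have h7 : decay N u / N ≤ N := by
          apply Nat.div_le_of_le_mul
          exact decay_le N u
        have h8 : N * (decay N u - decay N u / N) + N * (decay N u / N) = N * decay N u := by
          rw [← Nat.mul_add, Nat.sub_add_cancel (Nat.div_le_self _ _)]
        have h9 := Nat.mul_le_mul_left N h7
        omega
    have h4' : (N * decay N v : ℝ) ≤ y := by exact_mod_cast h4
    have h5' : (y : ℝ) ≤ N * decay N v + N * N := by exact_mod_cast h5
    have hid : (y : ℝ) / (N * N * N) - decay N v / (N * N) = (y - N * decay N v) / (N * N * N) := by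
      field_simp
    rw [hid, abs_of_nonneg (div_nonneg (by linarith) (by positivity)), div_le_div_iff₀
      (by positivity) h0]
    nlinarith [mul_pos h0 h0, mul_pos (mul_pos h0 h0) h0]
  · have h4 := h1 (N * N) (by omega)
    simp only [decide_eq_true_eq] at h4
    have h5 := (abs_le.1 (abs_decay_sub_exp_le hN (N * N))).2
    have h6 : Real.exp (-((N * N : ℕ) / (N : ℝ))) ≤ 1 / N := by
      have : ((N * N : ℕ) / N : ℝ) = N := by push_cast; field_simp
      rw [this]
      exact exp_neg_nat_le hN
    have h7 : (decay N (N * N) : ℝ) / (N * N) ≤ 3 / N := by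
      have : (3 : ℝ) / N = 2 / N + 1 / N := by ring
      linarith
    have h8 : (decay N v : ℝ) / (N * N) ≤ 3 / N := by
      refine le_trans ?_ h7
      gcongr
      exact decay_antitone N (by omega)
    have h9 : (y : ℝ) / (N * N * N) ≤ 3 / N := by
      refine le_trans ?_ h7
      have : (y : ℝ) ≤ N * decay N (N * N) := by exact_mod_cast h4.le
      calc (y : ℝ) / (N * N * N) ≤ N * decay N (N * N) / (N * N * N) := by gcongr
        _ = _ := by field_simp
    have h10 : 0 ≤ (decay N v : ℝ) / (N * N) := by positivity
    have h11 : 0 ≤ (y : ℝ) / (N * N * N) := by positivity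
    rw [abs_sub_le_iff]
    constructor <;> linarith

/-- Factors are exchanged one at a time; the remaining ones lie in `[0, 1]` and do not amplify the
error. -/
theorem abs_prod_sub_prod_le {ι : Type} (S : Finset ι) (f g : ι → ℝ)
    (hf : ∀ i, 0 ≤ f i ∧ f i ≤ 1) (hg : ∀ i, 0 ≤ g i ∧ g i ≤ 1) :
    |∏ i ∈ S, f i - ∏ i ∈ S, g i| ≤ ∑ i ∈ S, |f i - g i| := by
  classical
  induction S using Finset.induction_on with
  | empty => simp
  | insert i S hi ih =>
    rw [Finset.prod_insert hi, Finset.prod_insert hi, Finset.sum_insert hi]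
    have hid : f i * ∏ i ∈ S, f i - g i * ∏ i ∈ S, g i =
        (f i - g i) * ∏ i ∈ S, f i + g i * (∏ i ∈ S, f i - ∏ i ∈ S, g i) := by ring
    have hp0 : 0 ≤ ∏ i ∈ S, f i := Finset.prod_nonneg fun i _ => (hf i).1
    have hp1 : ∏ i ∈ S, f i ≤ 1 := Finset.prod_le_one (fun i _ => (hf i).1) fun i _ => (hf i).2
    rw [hid]
    refine (abs_add_le _ _).trans (add_le_add ?_ ?_)
    · rw [abs_mul, abs_of_nonneg hp0]
      exact mul_le_of_le_one_right (abs_nonneg _) hp1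
    · rw [abs_mul, abs_of_nonneg (hg i).1]
      exact (mul_le_of_le_one_left (abs_nonneg _) (hg i).2).trans ih

theorem Dist.laplace_mem (d : Dist) (κ : ℕ) : 0 ≤ d.laplace κ ∧ d.laplace κ ≤ 1 := by
  rw [← d.sum_prob_real]
  unfold Dist.laplace
  generalize d.atoms = l
  induction l with
  | nil => simp
  | cons a l ih =>
    have hp0 : (0 : ℝ) ≤ a.2 := by exact_mod_cast a.2.2
    have hx0 : (0 : ℝ) ≤ a.1 := by exact_mod_cast a.1.2
    have h1 : Real.exp (-(κ * (a.1 : ℝ))) ≤ 1 := Real.exp_le_one_iff.2 (by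
      rw [neg_nonpos]; positivity)
    have h2 := Real.exp_nonneg (-(κ * (a.1 : ℝ)))
    simp only [List.map_cons, List.sum_cons]
    constructor
    · exact add_nonneg (mul_nonneg hp0 h2) ih.1
    · exact add_le_add (mul_le_of_le_one_right hp0 h1) ih.2

/-- The accuracy that the terms require. -/
def termsCost (terms : List (ℕ × (ℕ × ℕ))) : ℕ :=
  (terms.map fun t => (t.2.1 + t.2.2) * (t.1 + 11)).sum

theorem le_spread {l : List Dist} {d : Dist} (hd : d ∈ l) : d.atoms.length ≤ spread l := by
  have : d.atoms.length + 1 ≤ (l.map fun d => d.atoms.length + 1).sum :=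
    List.single_le_sum (fun _ _ => Nat.zero_le _) _ (List.mem_map_of_mem hd)
  unfold spread
  omega

theorem length_le_spread (l : List Dist) : l.length ≤ spread l := by
  unfold spread
  induction l with
  | nil => simp
  | cons d l ih =>
    simp only [List.length_cons, List.map_cons, List.sum_cons]
    omega

theorem abs_exactObj_sub_le {n N : ℕ} (hN : 0 < N) (terms : List (ℕ × (ℕ × ℕ)))
    (π : Fin n → Dist) (S : Finset (Fin n)) :
    |exactObj terms π S - approxObj N terms π S / (N * N)| ≤
      termsCost terms * ((spread (List.ofFn π) : ℝ) * spread (List.ofFn π)) / N := by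
  have h0 : (0 : ℝ) < N := by exact_mod_cast hN
  set s : ℝ := Nat.cast (spread (List.ofFn π)) with hs
  have hs1 : (1 : ℝ) ≤ s := by
    rw [hs]
    have : 1 ≤ spread (List.ofFn π) := Nat.le_add_left _ _
    exact_mod_cast this
  have hn : (n : ℝ) ≤ s := by
    have := length_le_spread (List.ofFn π)
    rw [List.length_ofFn] at this
    rw [hs]
    exact_mod_cast this
  have term : ∀ κ : ℕ, |∏ b ∈ S, (π b).laplace κ -
      (decay N (∑ b ∈ S, logWeight N κ (π b)) : ℝ) / (N * N)| ≤ (κ + 11) * (s * s) / N := by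
    intro κ
    have h1 := abs_decay_sub_exp_le hN (∑ b ∈ S, logWeight N κ (π b))
    have hexp : Real.exp (-((∑ b ∈ S, logWeight N κ (π b) : ℕ) / (N : ℝ))) =
        ∏ b ∈ S, Real.exp (-(logWeight N κ (π b) / N)) := by
      rw [← Real.exp_sum, Finset.sum_neg_distrib]
      push_cast
      rw [Finset.sum_div]
    have h2 := abs_prod_sub_prod_le S (fun b => (π b).laplace κ)
      (fun b => Real.exp (-(logWeight N κ (π b) / N))) (fun b => (π b).laplace_mem κ)
      fun b => ⟨Real.exp_nonneg _, Real.exp_le_one_iff.2 (by rw [neg_nonpos]; positivity)⟩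
    have h3 : ∀ b ∈ S, |(π b).laplace κ - Real.exp (-(logWeight N κ (π b) / N))| ≤
        (κ + 8 + s) / N := by
      intro b _
      have h4 := abs_laplace_sub_le hN κ (π b)
      have h5 := abs_laplaceApprox_sub_le hN κ (π b)
      have h6 : ((π b).atoms.length : ℝ) ≤ s := by
        rw [hs]
        exact_mod_cast le_spread (List.mem_ofFn.2 ⟨b, rfl⟩)
      calc _ = |((π b).laplace κ - laplaceApprox N κ (π b) / (N * N * N)) +
            (laplaceApprox N κ (π b) / (N * N * N) - Real.exp (-(logWeight N κ (π b) / N)))| := by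
            congr 1; ring
        _ ≤ (κ + 3 + (π b).atoms.length) / N + 5 / N :=
            (abs_add_le _ _).trans (add_le_add h4 h5)
        _ = (κ + 8 + (π b).atoms.length) / N := by ring
        _ ≤ _ := by gcongr
    have h4 := Finset.sum_le_card_nsmul S _ _ h3
    have h5 : (S.card : ℝ) ≤ s := by
      have : S.card ≤ n := by simpa using S.card_le_univ
      exact le_trans (by exact_mod_cast this) hn
    rw [hexp] at h1
    rw [nsmul_eq_mul] at h4
    have h6 : (S.card : ℝ) * ((κ + 8 + s) / N) ≤ s * ((κ + 8 + s) / N) := by gcongr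
    -- At most `s` factors, plus `2/N` for the final `decay`; `s ≥ 1` absorbs everything, with `11 =
    -- 8 + 1 + 2`.
    have h7 : s * ((κ + 8 + s) / N) + 2 / N ≤ (κ + 11) * (s * s) / N := by
      rw [← mul_div_assoc, ← add_div]
      gcongr
      have hκ : (0 : ℝ) ≤ κ := Nat.cast_nonneg κ
      nlinarith [mul_nonneg hκ (by nlinarith : (0 : ℝ) ≤ s * s - s)]
    calc _ = |(∏ b ∈ S, (π b).laplace κ - ∏ b ∈ S, Real.exp (-(logWeight N κ (π b) / N))) -
          ((decay N (∑ b ∈ S, logWeight N κ (π b)) : ℝ) / (N * N) -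
            ∏ b ∈ S, Real.exp (-(logWeight N κ (π b) / N)))| := by congr 1; ring
      _ ≤ _ := (abs_sub _ _).trans (by linarith)
  unfold exactObj approxObj termsCost
  induction terms with
  | nil => simp
  | cons t l ih =>
    have h1 := term t.1
    have h2 : |(t.2.1 : ℝ) - t.2.2| ≤ t.2.1 + t.2.2 := by
      rw [abs_sub_le_iff]
      constructor <;>
        linarith [(Nat.cast_nonneg t.2.1 : (0 : ℝ) ≤ _), (Nat.cast_nonneg t.2.2 : (0 : ℝ) ≤ _)]
    have h3 : |((t.2.1 : ℝ) - t.2.2) * (∏ b ∈ S, (π b).laplace t.1 -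
        (decay N (∑ b ∈ S, logWeight N t.1 (π b)) : ℝ) / (N * N))| ≤
        (t.2.1 + t.2.2) * ((t.1 + 11) * (s * s) / N) := by
      rw [abs_mul]
      exact mul_le_mul h2 h1 (abs_nonneg _) (by positivity)
    simp only [List.map_cons, List.sum_cons]
    refine le_trans (le_of_eq ?_) ((abs_add_le _ _).trans ((add_le_add h3 ih).trans (le_of_eq ?_)))
    · congr 1; push_cast; ring
    · push_cast; ring

/-- The algorithm finds a feasible solution whose objective is optimal up to a small error. -/
theorem exists_approx_algorithm (hA : A.ExactPseudoPoly) (terms : Input A → List (ℕ × (ℕ × ℕ)))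
    (hterms : PT terms) (h : ℚ≥0 → ℕ) (hlen : ∀ c, (terms c).length ≤ h c.ε)
    (a : Input A → ℕ) (ha : PT a) (ha0 : ∀ c, 0 < a c) :
    ∃ out : Input A → Data, PT out ∧ ∀ c,
      (∃ S, A.Feasible c.x S ∧ (∀ S', A.Feasible c.x S' →
        exactObj (terms c) c.π S' ≤ exactObj (terms c) c.π S + 2 / a c) ∧
        out c = encAnswer (some S)) ∨
      ((¬ ∃ S, A.Feasible c.x S) ∧ out c = encAnswer (n := A.card c.x) none) := by
  have hcost : PT fun c => termsCost (terms c) :=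
    hterms.sum_map ((PT.arg.snd.fst.add PT.arg.snd.snd).mul (PT.arg.fst.add (PT.const 11)))
  -- This `N` makes the error of the objective at most `1 / a c`; it is incurred twice, for `S` and
  -- for `S'`. The `+ 1` keeps `N` positive.
  obtain ⟨out, hout, hspec⟩ := exists_algorithm hA terms hterms h hlen
    (fun c => (a c * termsCost (terms c) + 1) *
      (spread (List.ofFn c.π) * spread (List.ofFn c.π)))
    ((ha.mul hcost).succ.mul (PT.spread.mul PT.spread))
  refine ⟨out, hout, fun c => ?_⟩
  rcases hspec c with ⟨S, hS, hmax, ho⟩ | hno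
  · refine .inl ⟨S, hS, fun S' hS' => ?_, ho⟩
    set s := spread (List.ofFn c.π) with hs
    have hs0 : 0 < s := Nat.succ_pos _
    set N := (a c * termsCost (terms c) + 1) * (s * s) with hN
    have hN0 : 0 < N := by positivity
    have hacc : (termsCost (terms c) : ℝ) * ((s : ℝ) * s) / N ≤ 1 / a c := by
      have h1 : (0 : ℝ) < a c := by exact_mod_cast ha0 c
      have h2 : (0 : ℝ) < s := by exact_mod_cast hs0
      rw [div_le_div_iff₀ (by exact_mod_cast hN0) h1, hN]
      push_cast
      nlinarith [mul_pos h2 h2]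
    have h1 := (abs_le.1 ((abs_exactObj_sub_le hN0 (terms c) c.π S).trans hacc)).1
    have h2 := (abs_le.1 ((abs_exactObj_sub_le hN0 (terms c) c.π S').trans hacc)).2
    have h3 : (approxObj N (terms c) c.π S' : ℝ) / (N * N) ≤
        approxObj N (terms c) c.π S / (N * N) := by
      gcongr
      exact_mod_cast hmax S' hS'
    have h4 : (2 : ℝ) / a c = 1 / a c + 1 / a c := by ring
    linarith
  · exact .inr hno

/-! ### Expectations -/

/-- The function `∑ (c⁺ - c⁻) exp (-κ y)` of `y`, where the sum is over the terms. -/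
noncomputable def expSum (terms : List (ℕ × (ℕ × ℕ))) (y : ℝ) : ℝ :=
  (terms.map fun t => ((t.2.1 : ℝ) - t.2.2) * Real.exp (-(t.1 * y))).sum

theorem Dist.integral_law (d : Dist) (f : ℝ → ℝ) :
    ∫ x, f x ∂d.law = (d.atoms.map fun a => (a.2 : ℝ) * f a.1).sum := by
  unfold Dist.law
  induction d.atoms with
  | nil => simp
  | cons a l ih =>
    have hl : Integrable f
        (l.map fun a => ENNReal.ofReal (a.2 : ℝ) • Measure.dirac (a.1 : ℝ)).sum := by
      clear ih
      induction l with
      | nil => simp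
      | cons b l ih =>
        rw [List.map_cons, List.sum_cons]
        exact ((integrable_dirac (by simp)).smul_measure ENNReal.ofReal_ne_top).add_measure ih
    have hp : (0 : ℝ) ≤ a.2 := by exact_mod_cast a.2.2
    rw [List.map_cons, List.sum_cons, List.map_cons, List.sum_cons, integral_add_measure
      ((integrable_dirac (by simp)).smul_measure ENNReal.ofReal_ne_top) hl, ih,
      integral_smul_measure, integral_dirac, ENNReal.toReal_ofReal hp, smul_eq_mul]

instance (d : Dist) : IsProbabilityMeasure d.law := by
  constructor
  have key : ∀ l : List (ℚ≥0 × ℚ≥0),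
      (l.map fun a => ENNReal.ofReal (a.2 : ℝ) • Measure.dirac (a.1 : ℝ)).sum Set.univ =
        ENNReal.ofReal (l.map fun a => (a.2 : ℝ)).sum := by
    intro l
    induction l with
    | nil => simp
    | cons a l ih =>
      have hp : (0 : ℝ) ≤ a.2 := by exact_mod_cast a.2.2
      have hs : 0 ≤ (l.map fun a => (a.2 : ℝ)).sum := List.sum_nonneg fun x hx => by
        obtain ⟨b, -, rfl⟩ := List.mem_map.1 hx
        exact_mod_cast b.2.2
      rw [List.map_cons, List.sum_cons, List.map_cons, List.sum_cons, Measure.add_apply, ih,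
        ENNReal.ofReal_add hp hs]
      simp
  rw [Dist.law, key, d.sum_prob_real, ENNReal.ofReal_one]

theorem Dist.ae_nonneg (d : Dist) : ∀ᵐ x ∂d.law, 0 ≤ x := by
  unfold Dist.law
  induction d.atoms with
  | nil => simp
  | cons a l ih =>
    rw [List.map_cons, List.sum_cons, ae_add_measure_iff]
    refine ⟨Measure.ae_smul_measure ?_ _, ih⟩
    rw [ae_dirac_iff measurableSet_Ici]
    exact_mod_cast a.1.2

instance {n : ℕ} (π : Fin n → Dist) : IsProbabilityMeasure (jointLaw π) := by
  unfold jointLaw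
  infer_instance

theorem ae_sum_nonneg {n : ℕ} (π : Fin n → Dist) (S : Finset (Fin n)) :
    ∀ᵐ X ∂jointLaw π, 0 ≤ ∑ b ∈ S, X b := by
  have h : ∀ᵐ X ∂jointLaw π, ∀ b, 0 ≤ X b :=
    eventually_all.2 fun b => Measure.tendsto_eval_ae_ae.eventually (π b).ae_nonneg
  filter_upwards [h] with X hX using Finset.sum_nonneg fun b _ => hX b

theorem integrable_comp_sum {n : ℕ} (π : Fin n → Dist) (S : Finset (Fin n)) {g : ℝ → ℝ}
    (hg : ContinuousOn g (Set.Ici 0)) {C : ℝ} (hC : ∀ y, 0 ≤ y → |g y| ≤ C) :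
    Integrable (fun X => g (∑ b ∈ S, X b)) (jointLaw π) := by
  -- Nothing is known about `g` at negative arguments; truncation at `0` changes the integrand only
  -- on a null set.
  have hc : Continuous fun X : Fin n → ℝ => g (max (∑ b ∈ S, X b) 0) :=
    hg.comp_continuous (by fun_prop) fun X => Set.mem_Ici.2 (le_max_right _ _)
  have hi : Integrable (fun X : Fin n → ℝ => g (max (∑ b ∈ S, X b) 0)) (jointLaw π) :=
    .of_bound hc.aestronglyMeasurable C (.of_forall fun X => hC _ (le_max_right _ _))
  refine hi.congr ?_
  filter_upwards [ae_sum_nonneg π S] with X hX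
  rw [max_eq_left hX]

theorem continuous_expSum (terms : List (ℕ × (ℕ × ℕ))) : Continuous (expSum terms) := by
  unfold expSum
  induction terms with
  | nil => exact continuous_const
  | cons t l ih =>
    simp only [List.map_cons, List.sum_cons]
    exact Continuous.add (by fun_prop) ih

theorem abs_expSum_le (terms : List (ℕ × (ℕ × ℕ))) {y : ℝ} (hy : 0 ≤ y) :
    |expSum terms y| ≤ (terms.map fun t => |(t.2.1 : ℝ) - t.2.2|).sum := by
  unfold expSum
  induction terms with
  | nil => simp
  | cons t l ih =>
    simp only [List.map_cons, List.sum_cons]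
    refine (abs_add_le _ _).trans (add_le_add ?_ ih)
    rw [abs_mul, abs_of_nonneg (Real.exp_nonneg _)]
    exact mul_le_of_le_one_right (abs_nonneg _)
      (Real.exp_le_one_iff.2 (by rw [neg_nonpos]; positivity))

theorem integrable_expSum {n : ℕ} (π : Fin n → Dist) (S : Finset (Fin n))
    (terms : List (ℕ × (ℕ × ℕ))) :
    Integrable (fun X => expSum terms (∑ b ∈ S, X b)) (jointLaw π) :=
  integrable_comp_sum π S (continuous_expSum terms).continuousOn fun _ => abs_expSum_le terms

theorem integral_exp_sum {n : ℕ} (π : Fin n → Dist) (S : Finset (Fin n)) (κ : ℕ) :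
    ∫ X, Real.exp (-(κ * ∑ b ∈ S, X b)) ∂jointLaw π = ∏ b ∈ S, (π b).laplace κ := by
  -- Coordinates outside `S` get the constant factor `1`, so that the product runs over all
  -- coordinates of the joint law.
  have h := integral_fintype_prod_eq_prod (𝕜 := ℝ) (μ := fun b => (π b).law)
    (fun (b : Fin n) (x : ℝ) => if b ∈ S then Real.exp (-(κ * x)) else 1)
  have h1 : ∀ X : Fin n → ℝ, Real.exp (-(κ * ∑ b ∈ S, X b)) =
      ∏ b, if b ∈ S then Real.exp (-(κ * X b)) else 1 := by
    intro X
    rw [Finset.prod_ite_mem, Finset.univ_inter, ← Real.exp_sum, Finset.sum_neg_distrib,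
      Finset.mul_sum]
  simp only [h1]
  refine h.trans ?_
  have h2 : ∀ b, ∫ x, (if b ∈ S then Real.exp (-(κ * x)) else 1) ∂(π b).law =
      if b ∈ S then (π b).laplace κ else 1 := by
    intro b
    split
    · exact (π b).integral_law _
    · simp
  simp only [h2]
  rw [Finset.prod_ite_mem, Finset.univ_inter]

theorem integral_expSum {n : ℕ} (π : Fin n → Dist) (S : Finset (Fin n))
    (terms : List (ℕ × (ℕ × ℕ))) :
    ∫ X, expSum terms (∑ b ∈ S, X b) ∂jointLaw π = exactObj terms π S := by
  induction terms with
  | nil => simp [expSum, exactObj]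
  | cons t l ih =>
    have h : ∀ y, expSum (t :: l) y = expSum [t] y + expSum l y := by
      intro y; simp [expSum]
    simp only [h]
    rw [integral_add (integrable_expSum π S [t]) (integrable_expSum π S l), ih]
    simp only [expSum, exactObj, List.map_cons, List.map_nil, List.sum_cons, List.sum_nil, add_zero]
    rw [integral_const_mul, integral_exp_sum]

/-! ### Expected utility -/

theorem list_sum_range_map {M : Type} [AddCommMonoid M] (f : ℕ → M) (n : ℕ) :
    ((List.range n).map f).sum = ∑ i ∈ Finset.range n, f i := by
  induction n with
  | zero => simp
  | succ n ih => simp [List.range_succ, Finset.sum_range_succ, ih]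

/-- In the variable `t = exp (-y)` the limit at infinity is continuity at `t = 0`, so Weierstrass
applies on `[0, 1]` with error `δ / 2`. Rounding the `D` coefficients to multiples of `1 / H` costs
at most `D / H ≤ δ / 2`. -/
theorem exists_expSum_near {μ : ℝ → ℝ} (hμ : ContinuousOn μ (Set.Ici 0))
    (hlim : Tendsto μ atTop (𝓝 0)) {δ : ℝ} (hδ : 0 < δ) :
    ∃ (terms : List (ℕ × (ℕ × ℕ))) (H : ℕ), 0 < H ∧
      ∀ y, 0 ≤ y → |μ y - expSum terms y / H| ≤ δ := by
  let f : ℝ → ℝ := fun t => if t = 0 then 0 else μ (-Real.log t)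
  have hf : ContinuousOn f (Set.Icc 0 1) := by
    have h1 : ContinuousOn f (Set.Ioc 0 1) := by
      have : ContinuousOn (fun t => μ (-Real.log t)) (Set.Ioc 0 1) :=
        hμ.comp ((Real.continuousOn_log.mono fun t ht => ht.1.ne').neg) fun t ht =>
          neg_nonneg.2 (Real.log_nonpos ht.1.le ht.2)
      exact this.congr fun t ht => if_neg ht.1.ne'
    intro t ht
    rcases ht.1.eq_or_lt with rfl | ht0
    · rw [← continuousWithinAt_sdiff_self]
      have h2 : Tendsto (fun t => μ (-Real.log t)) (𝓝[>] 0) (𝓝 0) :=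
        hlim.comp (tendsto_neg_atBot_atTop.comp Real.tendsto_log_nhdsGT_zero)
      have h3 : ContinuousWithinAt f (Set.Ioi 0) 0 := by
        have h0 : f 0 = 0 := if_pos rfl
        rw [ContinuousWithinAt, h0]
        refine h2.congr' ?_
        filter_upwards [self_mem_nhdsWithin] with t ht
        exact (if_neg (ne_of_gt ht)).symm
      exact h3.mono fun t ht => lt_of_le_of_ne ht.1.1 (Ne.symm ht.2)
    · refine (h1 t ⟨ht0, ht.2⟩).mono_of_mem_nhdsWithin ?_
      filter_upwards [self_mem_nhdsWithin, mem_nhdsWithin_of_mem_nhds (Ioi_mem_nhds ht0)]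
        with s hs hs' using ⟨hs', hs.2⟩
  obtain ⟨p, hp⟩ := exists_polynomial_near_of_continuousOn 0 1 f hf (δ / 2) (by linarith)
  set D := p.natDegree + 1 with hD
  obtain ⟨H, hH⟩ := exists_nat_gt (D / (δ / 2) : ℝ)
  have hH0 : (0 : ℝ) < H := lt_of_le_of_lt (by positivity) hH
  let z : ℕ → ℤ := fun k => ⌊H * p.coeff k⌋
  refine ⟨(List.range D).map fun k => (k, ((z k).toNat, (-z k).toNat)), H,
    by exact_mod_cast hH0, fun y hy => ?_⟩
  have hsum : expSum ((List.range D).map fun k => (k, ((z k).toNat, (-z k).toNat))) y =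
      ∑ k ∈ Finset.range D, (z k : ℝ) * Real.exp (-y) ^ k := by
    unfold expSum
    rw [List.map_map, list_sum_range_map]
    refine Finset.sum_congr rfl fun k _ => ?_
    simp only [Function.comp]
    rw [← Real.exp_nat_mul, mul_neg]
    congr 1
    have : (((z k).toNat : ℤ) - (-z k).toNat : ℤ) = z k := by omega
    exact_mod_cast this
  have ht0 : 0 < Real.exp (-y) := Real.exp_pos _
  have ht1 : Real.exp (-y) ≤ 1 := Real.exp_le_one_iff.2 (by linarith)
  have h1 := hp (Real.exp (-y)) ⟨ht0.le, ht1⟩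
  have h2 : f (Real.exp (-y)) = μ y := by
    simp only [f]
    rw [if_neg ht0.ne', Real.log_exp, neg_neg]
  rw [h2, Polynomial.eval_eq_sum_range] at h1
  have h3 : |∑ k ∈ Finset.range D, p.coeff k * Real.exp (-y) ^ k -
      (∑ k ∈ Finset.range D, (z k : ℝ) * Real.exp (-y) ^ k) / H| ≤ δ / 2 := by
    rw [Finset.sum_div, ← Finset.sum_sub_distrib]
    refine (Finset.abs_sum_le_sum_abs _ _).trans ?_
    have h4 : ∀ k ∈ Finset.range D, |p.coeff k * Real.exp (-y) ^ k -
        (z k : ℝ) * Real.exp (-y) ^ k / H| ≤ 1 / H := by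
      intro k _
      have h5 : p.coeff k * Real.exp (-y) ^ k - (z k : ℝ) * Real.exp (-y) ^ k / H =
          (H * p.coeff k - z k) / H * Real.exp (-y) ^ k := by field_simp
      have h6 : (0 : ℝ) ≤ H * p.coeff k - z k := sub_nonneg.2 (Int.floor_le _)
      have h7 : H * p.coeff k - z k ≤ 1 := by
        have := (Int.lt_floor_add_one (H * p.coeff k)).le
        simp only [z]
        linarith
      have h8 : Real.exp (-y) ^ k ≤ 1 := pow_le_one₀ ht0.le ht1
      rw [h5, abs_of_nonneg (by positivity)]
      calc _ ≤ 1 / (H : ℝ) * 1 := by gcongr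
        _ = _ := mul_one _
    refine (Finset.sum_le_card_nsmul _ _ _ h4).trans ?_
    rw [Finset.card_range, nsmul_eq_mul, mul_one_div, div_le_iff₀ hH0]
    rw [div_lt_iff₀ (by linarith)] at hH
    linarith
  rw [hsum]
  have h5 := abs_sub_comm (μ y) (∑ k ∈ Finset.range D, p.coeff k * Real.exp (-y) ^ k)
  calc _ = |(μ y - ∑ k ∈ Finset.range D, p.coeff k * Real.exp (-y) ^ k) +
        (∑ k ∈ Finset.range D, p.coeff k * Real.exp (-y) ^ k -
          (∑ k ∈ Finset.range D, (z k : ℝ) * Real.exp (-y) ^ k) / H)| := by congr 1; ring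
    _ ≤ δ / 2 + δ / 2 := (abs_add_le _ _).trans (add_le_add (by rw [h5]; exact h1.le) h3)
    _ = δ := by ring

theorem abs_expUtility_sub_le {μ : ℝ → ℝ} (hμ : ContinuousOn μ (Set.Ici 0))
    {terms : List (ℕ × (ℕ × ℕ))} {H : ℕ} {δ : ℝ}
    (h : ∀ y, 0 ≤ y → |μ y - expSum terms y / H| ≤ δ) {n : ℕ} (π : Fin n → Dist)
    (S : Finset (Fin n)) : |expUtility μ π S - exactObj terms π S / H| ≤ δ := by
  have hbd : ∀ y, 0 ≤ y →
      |μ y| ≤ δ + (terms.map fun t => |(t.2.1 : ℝ) - t.2.2|).sum / H := by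
    intro y hy
    calc |μ y| = |(μ y - expSum terms y / H) + expSum terms y / H| := by congr 1; ring
      _ ≤ _ := (abs_add_le _ _).trans (add_le_add (h y hy) (by
        rw [abs_div, Nat.abs_cast]
        gcongr
        exact abs_expSum_le terms hy))
  rw [expUtility, ← integral_expSum, ← integral_div, ← integral_sub
    (integrable_comp_sum π S hμ hbd) ((integrable_expSum π S terms).div_const _)]
  have := norm_integral_le_of_norm_le_const (μ := jointLaw π)
    (f := fun X => μ (∑ b ∈ S, X b) - expSum terms (∑ b ∈ S, X b) / H) (C := δ) (by
      filter_upwards [ae_sum_nonneg π S] with X hX using h _ hX)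
  simpa using this

theorem eumPolyTime (hA : A.ExactPseudoPoly) {μ : ℝ → ℝ} (hμ : ContinuousOn μ (Set.Ici 0))
    (hlim : Tendsto μ atTop (𝓝 0)) {ε : ℝ} (hε : 0 < ε) : A.EUMPolyTime μ ε := by
  -- The approximation is used twice, costing `ε / 2`; the choice of `a` makes the algorithm's error
  -- `2 / a` at most `ε / 2`.
  obtain ⟨terms, H, hH, hterms⟩ := exists_expSum_near hμ hlim (δ := ε / 4) (by linarith)
  obtain ⟨a, ha⟩ := exists_nat_gt (4 / ε)
  have ha0 : (0 : ℝ) < a := lt_trans (by positivity) ha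
  obtain ⟨out, ⟨P, T, ⟨k, hk⟩, -, hrun⟩, hspec⟩ := exists_approx_algorithm hA (fun _ => terms)
    (PT.const terms) (fun _ => terms.length) (fun _ => le_rfl) (fun _ => a) (PT.const a)
    (fun _ => by exact_mod_cast ha0)
  -- The terms are fixed here, so a dummy parameter `0` is put in front of the input.
  obtain ⟨P₀, t₀, hP₀⟩ := PT.exists_prog_const (encRat 0)
  refine ⟨.seq (.pair P₀ .skip) P,
    Polynomial.C (t₀ + 3) + (Polynomial.X + Polynomial.C ((encRat 0).size + 2)) ^ k 0,
    fun x hx π => ?_⟩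
  let c : Input A := ⟨0, x, hx, π⟩
  obtain ⟨t, ht, hr⟩ := hrun c
  refine ⟨out c, _, .seq (.pair (hP₀ _) (.skip _)) hr, ?_, ?_⟩
  · have h1 : t ≤ (sz c + 1) ^ k 0 := ht.trans (hk c)
    have h2 : sz c + 1 = (encStoch x π).size + ((encRat 0).size + 2) := by
      change (encRat 0).size + (encStoch x π).size + 1 + 1 = _
      omega
    simp only [Polynomial.eval_add, Polynomial.eval_C, Polynomial.eval_pow, Polynomial.eval_X]
    rw [← h2]
    omega
  · rcases hspec c with ⟨S, hS, hopt, ho⟩ | hno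
    · refine .inl ⟨S, hS, ?_, ho⟩
      have : Nonempty {S : Finset (Fin (A.card x)) // A.Feasible x S} := ⟨⟨S, hS⟩⟩
      rw [sub_le_iff_le_add]
      refine ciSup_le fun S' => ?_
      have h1 := (abs_le.1 (abs_expUtility_sub_le hμ hterms π S'.1)).2
      have h2 := (abs_le.1 (abs_expUtility_sub_le hμ hterms π S)).1
      have hH1 : (1 : ℝ) ≤ H := by exact_mod_cast hH
      have h3 : exactObj terms π S'.1 / H ≤ exactObj terms π S / H + 2 / a := by
        calc _ ≤ (exactObj terms π S + 2 / a) / H := by gcongr; exact hopt S'.1 S'.2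
          _ = exactObj terms π S / H + 2 / a / H := by ring
          _ ≤ _ := add_le_add le_rfl (div_le_self (by positivity) hH1)
      have h4 : (2 : ℝ) / a ≤ ε / 2 := by
        rw [div_lt_iff₀ hε] at ha
        rw [div_le_div_iff₀ ha0 (by norm_num)]
        linarith
      linarith
    · exact .inr hno

/-! ### Threshold probability -/

/-- The exponent `b` for which `1 - (1 - exp (-j² y)) ^ b` approximates a step at `y ≈ 1`. -/
def stepDegree (j : ℕ) : ℕ := 2 ^ j * ((j + 1) ^ ((j + 1) * (j * j)) / j ^ ((j + 1) * (j * j)) + 1)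

/-- The terms of `-(1 - exp (-j² y)) ^ b`. -/
def stepTerms (j b : ℕ) : List (ℕ × (ℕ × ℕ)) :=
  (List.range (b + 1)).map fun i =>
    (j * j * i, if decide (i % 2 ≤ 0) = true then (0, b.choose i) else (b.choose i, 0))

theorem expSum_stepTerms (j b : ℕ) (y : ℝ) :
    expSum (stepTerms j b) y = -(1 - Real.exp (-(j * j * y))) ^ b := by
  have h := add_pow (-Real.exp (-(j * j * y))) 1 b
  rw [show 1 - Real.exp (-(j * j * y)) = -Real.exp (-(j * j * y)) + 1 by ring, h,
    ← Finset.sum_neg_distrib, expSum, stepTerms, List.map_map, list_sum_range_map]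
  refine Finset.sum_congr rfl fun i _ => ?_
  have hexp : Real.exp (-((j * j * i : ℕ) * y)) = Real.exp (-(j * j * y)) ^ i := by
    rw [← Real.exp_nat_mul]
    congr 1
    push_cast
    ring
  simp only [Function.comp, hexp, one_pow, mul_one]
  rcases Nat.even_or_odd i with hi | hi
  · rw [hi.neg_pow]
    simp [Nat.even_iff.1 hi, mul_comm]
  · rw [hi.neg_pow]
    simp [Nat.odd_iff.1 hi, mul_comm]

/-- The computable stand-in for `exp (j²)` is `(1 + 1/j) ^ ((j + 1) j²)`: it lies between `exp (j²)`
and `exp (j² + j)` because `(1 + 1/j) ^ (j + 1) ≥ e ≥ (1 + 1/j) ^ j`. The factor `2` pays for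
rounding up. -/
theorem stepDegree_bounds {j : ℕ} (hj : 0 < j) :
    2 ^ j * Real.exp (j * j) ≤ stepDegree j ∧
      (stepDegree j : ℝ) ≤ 2 ^ j * (2 * Real.exp (j * j + j)) := by
  have h0 : (0 : ℝ) < j := by exact_mod_cast hj
  set ρ : ℝ := ((j + 1) / j : ℝ) ^ ((j + 1) * (j * j)) with hρ
  have hρ1 : Real.exp (j * j) ≤ ρ := by
    have h1 : Real.exp (1 / (j + 1)) ≤ (j + 1) / j := by
      have h2 := Real.one_sub_le_exp_neg (1 / ((j : ℝ) + 1))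
      have h3 : (1 : ℝ) - 1 / (j + 1) = j / (j + 1) := by field_simp; ring
      rw [h3, Real.exp_neg] at h2
      have h4 := inv_anti₀ (by positivity) h2
      rwa [inv_inv, inv_div] at h4
    calc Real.exp (j * j) = Real.exp (1 / (j + 1)) ^ ((j + 1) * (j * j)) := by
          rw [← Real.exp_nat_mul]
          congr 1
          push_cast
          field_simp
      _ ≤ _ := pow_le_pow_left₀ (Real.exp_nonneg _) h1 _
  have hρ2 : ρ ≤ Real.exp (j * j + j) := by
    have h1 : ((j : ℝ) + 1) / j ≤ Real.exp (1 / j) := by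
      have := Real.add_one_le_exp (1 / (j : ℝ))
      calc ((j : ℝ) + 1) / j = 1 / j + 1 := by field_simp; ring
        _ ≤ _ := this
    calc ρ ≤ Real.exp (1 / j) ^ ((j + 1) * (j * j)) := by rw [hρ]; gcongr
      _ = _ := by
          rw [← Real.exp_nat_mul]
          congr 1
          push_cast
          field_simp
  have hpos : 0 < j ^ ((j + 1) * (j * j)) := by positivity
  have hq : ρ = ((j + 1) ^ ((j + 1) * (j * j)) : ℕ) / (j ^ ((j + 1) * (j * j)) : ℕ) := by
    rw [hρ, div_pow]
    push_cast
    rfl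
  have hq1 : (((j + 1) ^ ((j + 1) * (j * j)) / j ^ ((j + 1) * (j * j)) : ℕ) : ℝ) ≤ ρ := by
    rw [hq]
    exact Nat.cast_div_le
  have hq2 : ρ ≤ ((j + 1) ^ ((j + 1) * (j * j)) / j ^ ((j + 1) * (j * j)) : ℕ) + 1 := by
    rw [hq, div_le_iff₀ (by exact_mod_cast hpos)]
    exact_mod_cast (Nat.lt_mul_of_div_lt (Nat.lt_succ_self _) hpos).le
  have h1 : 1 ≤ Real.exp (j * j + j) := Real.one_le_exp (by positivity)
  unfold stepDegree
  rw [Nat.cast_mul, Nat.cast_add, Nat.cast_pow, Nat.cast_one, Nat.cast_ofNat]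
  constructor
  · gcongr
    linarith
  · gcongr
    linarith

/-- With `z = exp (-j² y) ≥ exp (-j²)` one has `b z ≥ 2 ^ j ≥ j`, so `(1 - z) ^ b ≤ exp (-b z) ≤ exp
(-j)`. -/
theorem step_of_le_one {j : ℕ} (hj : 0 < j) {y : ℝ} (hy0 : 0 ≤ y) (hy : y ≤ 1) :
    (1 - Real.exp (-(j * j * y))) ^ stepDegree j ≤ 1 / j := by
  have h0 : (0 : ℝ) < j := by exact_mod_cast hj
  obtain ⟨hb, -⟩ := stepDegree_bounds hj
  set b := stepDegree j
  set z := Real.exp (-(j * j * y)) with hz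
  have hz1 : z ≤ 1 := Real.exp_le_one_iff.2 (by rw [neg_nonpos]; positivity)
  have h1 : (1 - z) ^ b ≤ Real.exp (-(b * z)) := by
    calc (1 - z) ^ b ≤ Real.exp (-z) ^ b := by
          have := Real.one_sub_le_exp_neg z
          have : 0 ≤ 1 - z := by linarith
          gcongr
      _ = _ := by rw [← Real.exp_nat_mul]; congr 1; ring
  have h2 : (j : ℝ) ≤ b * z := by
    have h3 : Real.exp (-(j * j)) ≤ z := Real.exp_le_exp.2 (by nlinarith [mul_pos h0 h0])
    have h4 : (j : ℝ) ≤ 2 ^ j := by exact_mod_cast (Nat.lt_two_pow_self).le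
    calc (j : ℝ) ≤ 2 ^ j := h4
      _ = 2 ^ j * Real.exp (j * j) * Real.exp (-(j * j)) := by
          rw [mul_assoc, ← Real.exp_add, add_neg_cancel, Real.exp_zero, mul_one]
      _ ≤ b * z := by gcongr
  exact h1.trans ((Real.exp_le_exp.2 (neg_le_neg h2)).trans (exp_neg_nat_le hj))

/-- By Bernoulli the left side is at most `b z`. The gap `4 / j` contributes `exp (-4j)`, of which
`exp (-2j)` pays for `2 ^ j` and for the excess `exp j` in `b`, leaving `2 exp (-2j) ≤ 1 / j`. -/
theorem step_of_ge {j : ℕ} (hj : 0 < j) {y : ℝ} (hy : 1 + 4 / j ≤ y) :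
    1 - (1 - Real.exp (-(j * j * y))) ^ stepDegree j ≤ 1 / j := by
  have h0 : (0 : ℝ) < j := by exact_mod_cast hj
  have hy0 : 0 ≤ y := le_trans (by positivity) hy
  obtain ⟨-, hb⟩ := stepDegree_bounds hj
  set b := stepDegree j
  set z := Real.exp (-(j * j * y)) with hz
  have hz0 : 0 ≤ z := Real.exp_nonneg _
  have hz1 : z ≤ 1 := Real.exp_le_one_iff.2 (by rw [neg_nonpos]; positivity)
  have h1 : 1 - b * z ≤ (1 - z) ^ b := by
    have := one_add_mul_le_pow (a := -z) (by linarith) b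
    calc 1 - b * z = 1 + b * -z := by ring
      _ ≤ (1 + -z) ^ b := this
      _ = _ := by rw [← sub_eq_add_neg]
  have h2 : z ≤ Real.exp (-(j * j + 4 * j)) := by
    refine Real.exp_le_exp.2 (neg_le_neg ?_)
    calc (j * j + 4 * j : ℝ) = j * j * (1 + 4 / j) := by field_simp
      _ ≤ _ := by gcongr
  have h3 : (2 : ℝ) ^ j ≤ Real.exp j := by
    calc (2 : ℝ) ^ j ≤ Real.exp 1 ^ j := by
          gcongr
          linarith [Real.add_one_le_exp (1 : ℝ)]
      _ = _ := by rw [← Real.exp_nat_mul, mul_one]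
  have h4 : b * z ≤ 1 / j := by
    calc b * z ≤ 2 ^ j * (2 * Real.exp (j * j + j)) * Real.exp (-(j * j + 4 * j)) := by gcongr
      _ ≤ Real.exp j * (2 * Real.exp (j * j + j)) * Real.exp (-(j * j + 4 * j)) := by gcongr
      _ = 2 * Real.exp (-((2 * j : ℕ) : ℝ)) := by
          rw [mul_left_comm, mul_assoc, ← Real.exp_add, ← Real.exp_add]
          congr 2
          push_cast
          ring
      _ ≤ 2 * (1 / (2 * j : ℕ)) := by
          gcongr
          exact exp_neg_nat_le (by omega)
      _ = 1 / j := by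
          push_cast
          field_simp
  linarith

/-! ### Threshold probabilities compared with the step function -/

section Probability

variable {n : ℕ} (π : Fin n → Dist) (S : Finset (Fin n))

theorem probLE_eq_integral (y : ℝ) :
    probLE π S y = ∫ X, Set.indicator {X : Fin n → ℝ | ∑ b ∈ S, X b ≤ y} 1 X ∂jointLaw π := by
  rw [integral_indicator_one (measurableSet_le (by fun_prop) measurable_const)]
  rfl

theorem integrable_indicator_sum_le (y : ℝ) :
    Integrable (Set.indicator {X : Fin n → ℝ | ∑ b ∈ S, X b ≤ y} (1 : (Fin n → ℝ) → ℝ))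
      (jointLaw π) :=
  (integrable_const (1 : ℝ)).indicator (measurableSet_le (by fun_prop) measurable_const)

theorem integral_add_expSum (terms : List (ℕ × (ℕ × ℕ))) (r : ℝ) :
    ∫ X, (r + expSum terms (∑ b ∈ S, X b)) ∂jointLaw π = r + exactObj terms π S := by
  rw [integral_add (integrable_const r) (integrable_expSum π S terms), integral_expSum]
  simp

/-- The indicator is bounded pointwise by the step function plus `1 / j`. The constant `1` of the
step is absent from `stepTerms`, as it does not affect the maximization. -/
theorem probLE_one_le {j : ℕ} (hj : 0 < j) :
    probLE π S 1 ≤ 1 + 1 / j + exactObj (stepTerms j (stepDegree j)) π S := by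
  rw [probLE_eq_integral, ← integral_add_expSum]
  refine integral_mono_ae (integrable_indicator_sum_le π S 1)
    ((integrable_const _).add (integrable_expSum π S _)) ?_
  filter_upwards [ae_sum_nonneg π S] with X hX
  rw [expSum_stepTerms]
  by_cases h : ∑ b ∈ S, X b ≤ 1
  · rw [Set.indicator_of_mem (by exact h)]
    have := step_of_le_one hj hX h
    simp only [Pi.one_apply]
    linarith
  · rw [Set.indicator_of_notMem (by exact h)]
    have h1 : (1 - Real.exp (-(j * j * ∑ b ∈ S, X b))) ^ stepDegree j ≤ 1 := by
      have h2 : Real.exp (-(j * j * ∑ b ∈ S, X b)) ≤ 1 :=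
        Real.exp_le_one_iff.2 (by rw [neg_nonpos]; positivity)
      exact pow_le_one₀ (by linarith) (by linarith [Real.exp_nonneg (-(j * j * ∑ b ∈ S, X b))])
    have h2 : (0 : ℝ) ≤ 1 / j := by positivity
    linarith

theorem le_probLE {j : ℕ} (hj : 0 < j) {r : ℝ} (hr : 4 / j ≤ r) :
    1 - 1 / j + exactObj (stepTerms j (stepDegree j)) π S ≤ probLE π S (1 + r) := by
  rw [probLE_eq_integral, ← integral_add_expSum]
  refine integral_mono_ae ((integrable_const _).add (integrable_expSum π S _))
    (integrable_indicator_sum_le π S _) ?_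
  filter_upwards [ae_sum_nonneg π S] with X hX
  rw [expSum_stepTerms]
  by_cases h : ∑ b ∈ S, X b ≤ 1 + r
  · rw [Set.indicator_of_mem (by exact h)]
    have h1 : 0 ≤ (1 - Real.exp (-(j * j * ∑ b ∈ S, X b))) ^ stepDegree j := by
      have h2 : Real.exp (-(j * j * ∑ b ∈ S, X b)) ≤ 1 :=
        Real.exp_le_one_iff.2 (by rw [neg_nonpos]; positivity)
      exact pow_nonneg (by linarith) _
    have h2 : (0 : ℝ) ≤ 1 / j := by positivity
    simp only [Pi.one_apply]
    linarith
  · rw [Set.indicator_of_notMem (by exact h)]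
    have := step_of_ge hj (y := ∑ b ∈ S, X b) (by linarith)
    linarith

end Probability

/-! ### Computing the terms of the step function from `ε` -/

theorem foldl_range_choose (b i : ℕ) :
    (List.range i).foldl (fun s k => s * (b - k) / (k + 1)) 1 = b.choose i := by
  induction i with
  | zero => simp
  | succ i ih =>
    rw [List.range_succ, List.foldl_append, List.foldl_cons, List.foldl_nil, ih,
      ← Nat.choose_succ_right_eq]
    exact Nat.mul_div_cancel _ (Nat.succ_pos i)

/-- Every intermediate value of the recurrence is itself a binomial coefficient, hence at most `2 ^
b`, which is bounded for a fixed parameter. -/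
theorem PT.choose {Γ : Type} [Coded Γ] [Env Γ] {b i : Γ → ℕ} (hb : PT b) (hi : PT i)
    (h : ℚ≥0 → ℕ) (hbh : ∀ c, b c ≤ h (par c)) : PT (fun c => (b c).choose (i c)) := by
  refine (foldl (st := fun c s k => s * (b c - k) / (k + 1)) hi.range (const 1)
    ((env.snd.mul (hb.wk.wk.sub arg)).div arg.succ) (B := fun c => 2 * 2 ^ b c + 1)
    (.of_par (fun e => 2 * 2 ^ h e + 1) fun c => ?_) fun c l₁ hl => ?_).congr
    fun c => (foldl_range_choose _ _).symm
  · have := Nat.pow_le_pow_right (n := 2) (by norm_num) (hbh c)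
    omega
  · have h1 : l₁ = List.range l₁.length := by
      have h2 := List.prefix_iff_eq_take.1 hl
      have h3 := hl.length_le
      rw [List.length_range] at h3
      rw [List.take_range, min_eq_left h3] at h2
      exact h2
    rw [h1, foldl_range_choose, sz_nat]
    have := Nat.choose_le_two_pow (b c) l₁.length
    omega

/-- The precision that is used for the parameter `ε`. -/
def stepPrecision (ε : ℚ≥0) : ℕ := 4 * 2 ^ ε.den.bits.length

theorem stepPrecision_pos (ε : ℚ≥0) : 0 < stepPrecision ε := by
  unfold stepPrecision
  positivity

/-- A positive `ε` is at least the reciprocal of its denominator, which is at most `2` to its bit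
length; no other information about `ε` is needed. -/
theorem four_div_stepPrecision_le {ε : ℚ≥0} (hε : 0 < ε) :
    4 / (stepPrecision ε : ℝ) ≤ (ε : ℝ) := by
  have h1 : ε.den ≤ 2 ^ ε.den.bits.length := by
    rw [Nat.size_eq_bits_len]
    exact (Nat.lt_size_self _).le
  have hd : (0 : ℝ) < ε.den := by exact_mod_cast ε.den_pos
  have hn : (1 : ℝ) ≤ ε.num := by exact_mod_cast Nat.one_le_iff_ne_zero.2 (by simpa using hε.ne')
  have h2 : (ε : ℝ) = ε.num / ε.den := by
    rw [eq_div_iff hd.ne']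
    exact_mod_cast NNRat.mul_den_eq_num ε
  have h3 : (ε.den : ℝ) ≤ 2 ^ ε.den.bits.length := by exact_mod_cast h1
  unfold stepPrecision
  push_cast
  rw [h2, div_le_div_iff₀ (by positivity) hd]
  nlinarith

theorem PT.stepPrecision : PT (fun c : Input A => stepPrecision c.ε) :=
  (const 4).mul ((const 2).pow_par param.ratDen.length (fun ε => ε.den.bits.length) fun _ => le_rfl)

theorem PT.stepDegree : PT (fun c : Input A => stepDegree (StochOpt.stepPrecision c.ε)) := by
  let e : ℚ≥0 → ℕ := fun ε => (StochOpt.stepPrecision ε + 1) *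
    (StochOpt.stepPrecision ε * StochOpt.stepPrecision ε)
  have he : PT fun c : Input A => e c.ε :=
    stepPrecision.succ.mul (stepPrecision.mul stepPrecision)
  exact ((const 2).pow_par stepPrecision StochOpt.stepPrecision fun _ => le_rfl).mul
    ((stepPrecision.succ.pow_par he e fun _ => le_rfl).div
      (stepPrecision.pow_par he e fun _ => le_rfl)).succ

theorem PT.stepTerms : PT (fun c : Input A =>
    stepTerms (StochOpt.stepPrecision c.ε) (StochOpt.stepDegree (StochOpt.stepPrecision c.ε))) := by
  have hch : PT fun d : Input A × ℕ =>
      (StochOpt.stepDegree (StochOpt.stepPrecision d.1.ε)).choose d.2 :=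
    stepDegree.wk.choose arg (fun ε => StochOpt.stepDegree (StochOpt.stepPrecision ε))
      fun _ => le_rfl
  exact stepDegree.succ.range.map (((stepPrecision.mul stepPrecision).wk.mul arg).pair
    (.ite ((arg.mod (const 2)).decide_le (const 0)) ((const 0).pair hch) (hch.pair (const 0))))

theorem tpmRelaxedAdditivePTAS (hA : A.ExactPseudoPoly) : A.TPMRelaxedAdditivePTAS := by
  obtain ⟨out, ⟨P, T, ⟨k, hk⟩, -, hrun⟩, hspec⟩ := exists_approx_algorithm hA _ PT.stepTerms
    (fun ε => stepDegree (stepPrecision ε) + 1) (fun c => by simp [stepTerms]) _ PT.stepPrecision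
    (fun c => stepPrecision_pos c.ε)
  refine ⟨P, fun ε hε => ⟨(Polynomial.X + Polynomial.C ((encRat ε).size + 2)) ^ k ε,
    fun x hx π => ?_⟩⟩
  let c : Input A := ⟨ε, x, hx, π⟩
  obtain ⟨t, ht, hr⟩ := hrun c
  refine ⟨out c, t, hr, ?_, ?_⟩
  · have h2 : sz c + 1 = (encStoch x π).size + ((encRat ε).size + 2) := by
      change (encRat ε).size + (encStoch x π).size + 1 + 1 = _
      omega
    simp only [Polynomial.eval_add, Polynomial.eval_C, Polynomial.eval_pow, Polynomial.eval_X]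
    rw [← h2]
    exact ht.trans (hk c)
  · rcases hspec c with ⟨S, hS, hopt, ho⟩ | hno
    · refine .inl ⟨S, hS, ?_, ho⟩
      have : Nonempty {S : Finset (Fin (A.card x)) // A.Feasible x S} := ⟨⟨S, hS⟩⟩
      rw [sub_le_iff_le_add]
      refine ciSup_le fun S' => ?_
      have hj := stepPrecision_pos ε
      have h1 := probLE_one_le π S'.1 hj
      have h2 := le_probLE π S hj (four_div_stepPrecision_le hε)
      have h3 := hopt S'.1 S'.2
      have h4 := four_div_stepPrecision_le hε
      -- The two outer summands are the errors of the step function for `S'` and `S`, the middle one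
      -- is the error of the algorithm.
      have h5 : (4 : ℝ) / stepPrecision ε = 1 / stepPrecision ε + 2 / stepPrecision ε +
        1 / stepPrecision ε := by ring
      simp only [c] at h3
      linarith
    · exact .inr hno

end StochOpt

theorem theorem1 (A : StochOpt.Problem) (hA : A.ExactPseudoPoly) :
    (∀ (μ : ℝ → ℝ) (α : ℝ≥0),
      (∀ x, 0 ≤ x → 0 ≤ μ x) →
      LipschitzOnWith α μ (Set.Ici 0) →
      Tendsto μ atTop (𝓝 0) →
      ∀ ε : ℝ, 0 < ε → A.EUMPolyTime μ ε) ∧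
    A.TPMRelaxedAdditivePTAS :=
  ⟨fun _ _ _ hμ hlim _ hε => StochOpt.eumPolyTime hA hμ.continuousOn hlim hε,
    StochOpt.tpmRelaxedAdditivePTAS hA⟩
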